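/- Let $\lambda_1,\lambda_2,\lambda_3>0$, $\mathbb T_i=[0,\lambda_i)$, $\mathbb T^3=\mathbb T_1\times\mathbb T_2\times\mathbb T_3$, let $d_1,d_2,d_3\in\mathbb R$ and $$e^{(1)}=\begin{pmatrix} d_1&1&1\\1&d_2&1\\1&1&d_3\end{pmatrix},\quad e^{(2)}=\begin{pmatrix} d_1&-1&-1\\-1&d_2&1\\-1&1&d_3\end{pmatrix},\quad e^{(3)}=\begin{pmatrix} d_1&1&-1\\1&d_2&-1\\-1&-1&d_3\end{pmatrix},\quad e^{(4)}=\begin{pmatrix} d_1&-1&1\\-1&d_2&-1\\1&-1&d_3\end{pmatrix}.$$ Let $e:\mathbb R^3\to\mathbb R^{3\times3}_{sym}$ be $\lambda_i$-periodic in $x_i$ for $i=1,2,3$ (almost everywhere), suppose that $e=\frac12(\nabla u+(\nabla u)^t)$ a.e. for some $u\in W^{1,1}_{loc}(\mathbb R^3;\mathbb R^3)$, and that $e(x)\in\{e^{(1)},e^{(2)},e^{(3)},e^{(4)}\}$ for a.e. $x$. Write $\langle e_{ij}\rangle$ for the average of $e_{ij}$ over $\mathbb T^3$; all identities below hold almost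 everywhere. By *strain potentials* of $e$ we mean Lipschitz functions $\Psi_{12}(x_1,x_2)$, $\Psi_{23}(x_2,x_3)$, $\Psi_{31}(x_3,x_1)$ on $\mathbb R^2$, where $\Psi_{ij}$ has period $\lambda_i$ in $x_i$ and period $\lambda_j$ in $x_j$, such that $$e_{12}=\partial_2\Psi_{23}+\partial_1\Psi_{31}+\langle e_{12}\rangle,\qquad e_{23}=\partial_3\Psi_{31}+\partial_2\Psi_{12}+\langle e_{23}\rangle,\qquad e_{31}=\partial_1\Psi_{12}+\partial_3\Psi_{23}+\langle e_{31}\rangle.$$ Then strain potentials of $e$ exist, and there is an index $i\in\{1,2,3\}$ such that $\partial_i e\equiv0$ in the sense of distributions. Moreover, let $\Psi_{12},\Psi_{23},\Psi_{31}$ be any strain potentials of $e$. If $\partial_2e\equiv0$, then $$e_{12}=\partial_1\Psi_{31}(x_3,x_1)+\langle e_{12}\rangle,\qquad e_{23}=\partial_3\Psi_{31}(x_3,x_1)+\langle e_{23}\rangle,$$ and at least one of the following holds: 1. $\Psi_{23}=\Psi_{23}(x_3)$ does not depend on $x_2$, and $e_{31}=\partial_3\Psi_{23}(x_3)+\langle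 e_{31}\rangle$; 2. $\Psi_{12}=\Psi_{12}(x_1)$ does not depend on $x_2$, and $e_{31}=\partial_1\Psi_{12}(x_1)+\langle e_{31}\rangle$. If $\partial_1e\equiv0$ or $\partial_3e\equiv0$, the same holds after the corresponding cyclic permutation of the indices. -/

import Mathlib

open MeasureTheory Set
open scoped ContDiff

noncomputable section

namespace CubicTrigonal

/-- Points of three-dimensional space. The indices `0, 1, 2` stand for the usual `1, 2, 3`, and
addition of indices is modulo three, so that `i, i + 1, i + 2` is the cyclic order. -/
abbrev Space : Type := Fin 3 → ℝ

/-- Real three-by-three matrices. -/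
abbrev Mat : Type := Matrix (Fin 3) (Fin 3) ℝ

/-- The `i`-th coordinate vector. -/
def unitVec (i : Fin 3) : Space := Pi.single i 1

/-- `g` is the weak (distributional) `i`-th partial derivative of `f` on the whole space, both
functions being locally integrable. -/
def HasWeakPartial (i : Fin 3) (f g : Space → ℝ) : Prop :=
  LocallyIntegrable f ∧ LocallyIntegrable g ∧
    ∀ φ : Space → ℝ, ContDiff ℝ ∞ φ → HasCompactSupport φ →
      ∫ x, f x * fderiv ℝ φ x (unitVec i) = - ∫ x, g x * φ x

/-- `e = (∇u + (∇u)ᵀ) / 2` almost everywhere, for some `u : ℝ³ → ℝ³` of class `W^{1,1}_loc` with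
weak gradient `G` (`G a b` is the weak `b`-th partial derivative of the component `u a`). -/
def IsSymmetrizedGradient (e : Space → Mat) : Prop :=
  ∃ (u : Fin 3 → Space → ℝ) (G : Fin 3 → Fin 3 → Space → ℝ),
    (∀ a b, HasWeakPartial b (u a) (G a b)) ∧
    ∀ᵐ x : Space, ∀ a b, e x a b = (G a b x + G b a x) / 2

/-- `e` is (almost everywhere) periodic with period `ℓ i` in the `i`-th coordinate. -/
def IsTorusPeriodic (ℓ : Fin 3 → ℝ) (e : Space → Mat) : Prop :=
  ∀ i, ∀ᵐ x : Space, e (x + ℓ i • unitVec i) = e x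

/-- The four stress-free strains, with diagonal entries `d`. -/
def wells (d : Fin 3 → ℝ) : Set Mat :=
  {!![d 0, 1, 1; 1, d 1, 1; 1, 1, d 2],
   !![d 0, -1, -1; -1, d 1, 1; -1, 1, d 2],
   !![d 0, 1, -1; 1, d 1, -1; -1, -1, d 2],
   !![d 0, -1, 1; -1, d 1, -1; 1, -1, d 2]}

/-- The period cell `[0, ℓ₀) × [0, ℓ₁) × [0, ℓ₂)`. -/
def cell (ℓ : Fin 3 → ℝ) : Set Space := Set.pi univ fun i => Ico 0 (ℓ i)

/-- The average of the component `e_ab` over the period cell. -/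
def avg (ℓ : Fin 3 → ℝ) (e : Space → Mat) (a b : Fin 3) : ℝ := ⨍ x in cell ℓ, e x a b

/-- Partial derivative of a function of two variables in its first variable. It is used only for
Lipschitz functions, for which it exists almost everywhere. -/
def dFst (F : ℝ × ℝ → ℝ) (s t : ℝ) : ℝ := deriv (fun s' => F (s', t)) s

/-- Partial derivative of a function of two variables in its second variable. -/
def dSnd (F : ℝ × ℝ → ℝ) (s t : ℝ) : ℝ := deriv (fun t' => F (s, t')) t

/-- `Ψ` is a family of periodic Lipschitz potentials for the off-diagonal strains: `Ψ i` is the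
function `Ψ_{i,i+1}(x_i, x_{i+1})`, and for every index `i`, almost everywhere,
`e_{i,i+1} = ∂_{i+1} Ψ_{i+1,i+2} + ∂_i Ψ_{i+2,i} + ⨍ e_{i,i+1}`. -/
structure IsStrainPotential (ℓ : Fin 3 → ℝ) (e : Space → Mat) (Ψ : Fin 3 → ℝ × ℝ → ℝ) :
    Prop where
  lipschitz : ∀ i, ∃ K : NNReal, LipschitzWith K (Ψ i)
  periodic_fst : ∀ i s t, Ψ i (s + ℓ i, t) = Ψ i (s, t)
  periodic_snd : ∀ i s t, Ψ i (s, t + ℓ (i + 1)) = Ψ i (s, t)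
  decomposition : ∀ i, ∀ᵐ x : Space,
    e x i (i + 1) = dFst (Ψ (i + 1)) (x (i + 1)) (x (i + 2))
      + dSnd (Ψ (i + 2)) (x (i + 2)) (x i) + avg ℓ e i (i + 1)

/-- `∂_i e = 0` in the sense of distributions. -/
def PartialVanishes (i : Fin 3) (e : Space → Mat) : Prop :=
  ∀ a b, HasWeakPartial i (fun x => e x a b) (fun _ => 0)

/-- The part common to both two-dimensional decompositions when `∂_i e = 0`. In the usual
numbering and for `i` the second index it reads `e₁₂ = ∂₁ Ψ₃₁(x₃, x₁) + ⨍ e₁₂` and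
`e₂₃ = ∂₃ Ψ₃₁(x₃, x₁) + ⨍ e₂₃`. -/
def CommonPart (ℓ : Fin 3 → ℝ) (e : Space → Mat) (Ψ : Fin 3 → ℝ × ℝ → ℝ) (i : Fin 3) : Prop :=
  (∀ᵐ x : Space, e x (i + 2) i =
    dSnd (Ψ (i + 1)) (x (i + 1)) (x (i + 2)) + avg ℓ e (i + 2) i) ∧
  (∀ᵐ x : Space, e x i (i + 1) =
    dFst (Ψ (i + 1)) (x (i + 1)) (x (i + 2)) + avg ℓ e i (i + 1))

/-- First form. For `i` the second index: `Ψ₂₃ = Ψ₂₃(x₃)` and `e₃₁ = ∂₃ Ψ₂₃(x₃) + ⨍ e₃₁`. -/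
def DecompositionOne (ℓ : Fin 3 → ℝ) (e : Space → Mat) (Ψ : Fin 3 → ℝ × ℝ → ℝ) (i : Fin 3) :
    Prop :=
  CommonPart ℓ e Ψ i ∧
  ∃ ψ : ℝ → ℝ, (∀ s t, Ψ i (s, t) = ψ t) ∧
    ∀ᵐ x : Space, e x (i + 1) (i + 2) = deriv ψ (x (i + 1)) + avg ℓ e (i + 1) (i + 2)

/-- Second form. For `i` the second index: `Ψ₁₂ = Ψ₁₂(x₁)` and `e₃₁ = ∂₁ Ψ₁₂(x₁) + ⨍ e₃₁`. -/
def DecompositionTwo (ℓ : Fin 3 → ℝ) (e : Space → Mat) (Ψ : Fin 3 → ℝ × ℝ → ℝ) (i : Fin 3) :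
    Prop :=
  CommonPart ℓ e Ψ i ∧
  ∃ ψ : ℝ → ℝ, (∀ s t, Ψ (i + 2) (s, t) = ψ s) ∧
    ∀ᵐ x : Space, e x (i + 1) (i + 2) = deriv ψ (x (i + 2)) + avg ℓ e (i + 1) (i + 2)

end CubicTrigonal

end

/-! The off-diagonal entries of every well are signs whose product is 1, and the diagonal is fixed.
Everything rests on these facts.

Potentials. Since each `e_aa` is constant, the mollified displacement has `∂_b u_a` independent of
`x_a`. Its increment over a period has zero symmetrized gradient, hence constant skew gradient;
commutation of the three period shifts makes this gradient vanish
(`sub_eq_of_periodic_symmGradient`). Bounded strains then bound the full gradient, so `u` is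
Lipschitz and equals a linear map plus a periodic part. Half the `a`-th periodic component does not
depend on `x_a`, and is the potential in the other two variables.

Rigidity. With the variable shared by two potentials frozen, a strain is a sum of functions of
separate variables with values `±1`, so one summand is constant (`slice_const_or`). The product
rule, restricted to slices where one potential is frozen, becomes a transport equation for another;
its characteristics spread constancy from one slice to all (`slice_const_of_transport`,
`fst_const_of_not_const`). Combinatorics on the cyclic triple then yields a coordinate on which no
potential depends (`exists_potentials_const`), and `e` is invariant in that direction.

Conversely, if `∂_i e = 0`, any potentials whatsoever are independent of `x_i`, because a periodic
function with translation-independent increments is constant; the dichotomy for slices then selects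
the form of the remaining strain. -/

noncomputable section

namespace CubicTrigonal

open Filter Topology

/-! ### Lipschitz functions and their slices -/

lemma absolutelyContinuousOnInterval_of_lipschitz {f : ℝ → ℝ} {K : NNReal}
    (hf : LipschitzWith K f) (a b : ℝ) : AbsolutelyContinuousOnInterval f a b :=
  (hf.lipschitzOnWith (s := uIcc a b)).absolutelyContinuousOnInterval

lemma lipschitz_sub_eq_of_ae_deriv_eq {f : ℝ → ℝ} {K : NNReal} (hf : LipschitzWith K f) {c : ℝ}
    (h : ∀ᵐ t, deriv f t = c) (s t : ℝ) : f t - f s = c * (t - s) := by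
  rw [← (absolutelyContinuousOnInterval_of_lipschitz hf s t).integral_deriv_eq_sub,
    intervalIntegral.integral_congr_ae (g := fun _ => c) (h.mono fun x hx _ => hx)]
  simp [mul_comm]

lemma eq_of_ae_deriv_eq_of_periodic {f : ℝ → ℝ} {K : NNReal} (hf : LipschitzWith K f) {c T : ℝ}
    (hT : T ≠ 0) (hper : ∀ t, f (t + T) = f t) (h : ∀ᵐ t, deriv f t = c) (s t : ℝ) :
    f s = f t := by
  have h1 := lipschitz_sub_eq_of_ae_deriv_eq hf h 0 (0 + T)
  rw [hper, sub_self, add_sub_cancel_left] at h1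
  have hc : c = 0 := by
    rcases mul_eq_zero.1 h1.symm with h2 | h2
    · exact h2
    · exact absurd h2 hT
  have h2 := lipschitz_sub_eq_of_ae_deriv_eq hf h s t
  rw [hc, zero_mul] at h2
  linarith

/-- If the sum of two functions of separate variables takes only the values `1` and `-1`, then one
of the two functions is constant. -/
lemma ae_const_or_ae_const_of_add {h g : ℝ → ℝ}
    (H : ∀ᵐ q : ℝ × ℝ, h q.2 + g q.1 = 1 ∨ h q.2 + g q.1 = -1) :
    (∃ c, ∀ᵐ y, h y = c) ∨ (∃ c, ∀ᵐ x, g x = c) := by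
  have H' := Measure.ae_ae_of_ae_prod H
  obtain ⟨x0, hx0⟩ := H'.exists
  set p := 1 - g x0 with hp
  have hy : ∀ᵐ y, h y = p ∨ h y = p - 2 := by
    filter_upwards [hx0] with y hy
    rcases hy with hy | hy
    · left; linarith
    · right; linarith
  by_cases h1 : ∀ᵐ y, h y = p
  · exact Or.inl ⟨p, h1⟩
  by_cases h2 : ∀ᵐ y, h y = p - 2
  · exact Or.inl ⟨_, h2⟩
  right
  -- Here `h` takes both values `p` and `p - 2` on non-null sets. For almost every `x` both `p + g
  -- x` and `p - 2 + g x` are signs, and two signs differing by 2 must be `1` and `-1`.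
  refine ⟨1 - p, ?_⟩
  filter_upwards [H'] with x hx
  have f1 : ∃ᵐ y, h y = p - 2 := by
    have : ∃ᵐ y, ¬ h y = p := not_eventually.1 h1
    exact (this.and_eventually hy).mono fun y hy => hy.2.resolve_left hy.1
  have f2 : ∃ᵐ y, h y = p := by
    have : ∃ᵐ y, ¬ h y = p - 2 := not_eventually.1 h2
    exact (this.and_eventually hy).mono fun y hy => hy.2.resolve_right hy.1
  obtain ⟨y1, e1, e1'⟩ := (f1.and_eventually hx).exists
  obtain ⟨y2, e2, e2'⟩ := (f2.and_eventually hx).exists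
  simp only [e1, e2] at e1' e2'
  rcases e1' with e | e <;> rcases e2' with e' | e' <;> linarith

/-- Closedness upgrades constancy of almost every slice to constancy of every slice, via
`forall_of_ae_of_isClosed`. -/
lemma isClosed_setOf_forall_eq {f : ℝ → ℝ → ℝ} (hf : Continuous fun p : ℝ × ℝ => f p.1 p.2) :
    IsClosed {z | ∀ s t, f z s = f z t} := by
  simp only [ofPred_forall]
  refine isClosed_iInter fun s => isClosed_iInter fun t => isClosed_eq ?_ ?_
  · exact hf.comp (by fun_prop : Continuous fun z : ℝ => (z, s))
  · exact hf.comp (by fun_prop : Continuous fun z : ℝ => (z, t))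

lemma forall_of_ae_of_isClosed {s : Set ℝ} (hs : IsClosed s) (h : ∀ᵐ x, x ∈ s) (x : ℝ) :
    x ∈ s := by
  have hd : Dense s := Measure.dense_of_ae h
  rw [← hs.closure_eq]
  exact hd x

lemma lipschitz_slice_fst {P : ℝ × ℝ → ℝ} {K : NNReal} (hP : LipschitzWith K P) (z : ℝ) :
    LipschitzWith K fun s => P (s, z) := by
  have := hP.comp (LipschitzWith.prodMk_right z)
  rwa [mul_one] at this

lemma lipschitz_slice_snd {P : ℝ × ℝ → ℝ} {K : NNReal} (hP : LipschitzWith K P) (z : ℝ) :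
    LipschitzWith K fun s => P (z, s) := by
  have := hP.comp (LipschitzWith.prodMk_left z)
  rwa [mul_one] at this

/-- At each value of the shared variable `z`, one of the potentials `P(y, z)`, `Q(z, x)` is
constant in its other variable. -/
lemma slice_const_or_slice_const {P Q : ℝ × ℝ → ℝ} {K L : NNReal} (hP : LipschitzWith K P)
    (hQ : LipschitzWith L Q) {S T : ℝ} (hS : S ≠ 0) (hT : T ≠ 0)
    (hPper : ∀ s t, P (s + S, t) = P (s, t)) (hQper : ∀ s t, Q (s, t + T) = Q (s, t)) {c : ℝ}
    (H : ∀ᵐ q : ℝ × ℝ × ℝ,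
      deriv (fun s => P (s, q.1)) q.2.2 + deriv (fun s => Q (q.1, s)) q.2.1 + c = 1 ∨
      deriv (fun s => P (s, q.1)) q.2.2 + deriv (fun s => Q (q.1, s)) q.2.1 + c = -1) (z : ℝ) :
    (∀ s t, P (s, z) = P (t, z)) ∨ (∀ s t, Q (z, s) = Q (z, t)) := by
  have hcl : IsClosed ({z | ∀ s t, P (s, z) = P (t, z)} ∪ {z | ∀ s t, Q (z, s) = Q (z, t)}) := by
    refine IsClosed.union ?_ ?_
    · exact isClosed_setOf_forall_eq (f := fun z s => P (s, z))
        (hP.continuous.comp continuous_swap)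
    · exact isClosed_setOf_forall_eq (f := fun z s => Q (z, s)) hQ.continuous
  refine forall_of_ae_of_isClosed hcl ?_ z
  filter_upwards [Measure.ae_ae_of_ae_prod H] with z hz
  rcases ae_const_or_ae_const_of_add (h := fun y => deriv (fun s => P (s, z)) y)
    (g := fun x => deriv (fun s => Q (z, s)) x + c)
    (hz.mono fun q hq => by simpa only [add_assoc] using hq) with ⟨k, hk⟩ | ⟨k, hk⟩
  · left
    intro s t
    exact eq_of_ae_deriv_eq_of_periodic (lipschitz_slice_fst hP z) hS (fun t => hPper t z) hk s t
  · right
    intro s t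
    refine eq_of_ae_deriv_eq_of_periodic (c := k - c) (lipschitz_slice_snd hQ z) hT
      (fun t => hQper z t) ?_ s t
    filter_upwards [hk] with x hx
    linarith

/-! ### Transport along characteristics -/

lemma hasDerivAt_slice_fst {R : ℝ × ℝ → ℝ} {p : ℝ × ℝ} (h : DifferentiableAt ℝ R p) :
    HasDerivAt (fun s => R (s, p.2)) (fderiv ℝ R p (1, 0)) p.1 := by
  have h1 : HasDerivAt (fun s : ℝ => (s, p.2)) ((1 : ℝ), (0 : ℝ)) p.1 :=
    (hasDerivAt_id p.1).prodMk (hasDerivAt_const p.1 p.2)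
  exact h.hasFDerivAt.comp_hasDerivAt p.1 h1

lemma hasDerivAt_slice_snd {R : ℝ × ℝ → ℝ} {p : ℝ × ℝ} (h : DifferentiableAt ℝ R p) :
    HasDerivAt (fun s => R (p.1, s)) (fderiv ℝ R p (0, 1)) p.2 := by
  have h1 : HasDerivAt (fun s : ℝ => (p.1, s)) ((0 : ℝ), (1 : ℝ)) p.2 :=
    (hasDerivAt_const p.2 p.1).prodMk (hasDerivAt_id p.2)
  exact h.hasFDerivAt.comp_hasDerivAt p.2 h1

/-- The shear `(y, x) ↦ (x - F y, y)` preserves null sets. -/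
lemma quasiMeasurePreserving_shear {F : ℝ → ℝ} (hF : Continuous F) :
    Measure.QuasiMeasurePreserving (fun q : ℝ × ℝ => (q.2 - F q.1, q.1)) := by
  have h1 : MeasurePreserving (fun q : ℝ × ℝ => (q.1, q.2 - F q.1)) :=
    (MeasurePreserving.id volume).skew_product (g := fun y x => x - F y)
      (by fun_prop) (ae_of_all _ fun y => by
        simpa [sub_eq_add_neg] using (measurePreserving_add_right volume (-F y)).map_eq)
  have h2 : MeasurePreserving (Prod.swap : ℝ × ℝ → ℝ × ℝ) := Measure.measurePreserving_swap
  exact (h2.comp h1).quasiMeasurePreserving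

/-- A Lipschitz function `R` which, wherever it depends on `x`, satisfies the transport equation
`R_y + k = F'(y) (R_x + c)`, is independent of `x` for all `y` if it is so for one `y`. -/
lemma slice_const_of_transport {R : ℝ × ℝ → ℝ} {F : ℝ → ℝ} {K L : NNReal}
    (hR : LipschitzWith K R) (hF : LipschitzWith L F) {c k : ℝ}
    (H : ∀ᵐ p : ℝ × ℝ, (∀ s t, R (s, p.2) = R (t, p.2)) ∨
      deriv (fun t => R (p.1, t)) p.2 + k = deriv F p.2 * (deriv (fun s => R (s, p.2)) p.1 + c))
    {y₂ : ℝ} (hy₂ : ∀ s t, R (s, y₂) = R (t, y₂)) (y s t : ℝ) : R (s, y) = R (t, y) := by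
  -- Pulled back by the shear, the equation holds at almost every point of almost every
  -- characteristic `y ↦ (x - F y, y)`.
  have H1 : ∀ᵐ q : ℝ × ℝ, DifferentiableAt ℝ R (q.2 - F q.1, q.1) ∧
      ((∀ s t, R (s, q.1) = R (t, q.1)) ∨
        fderiv ℝ R (q.2 - F q.1, q.1) (0, 1) + k
          = deriv F q.1 * (fderiv ℝ R (q.2 - F q.1, q.1) (1, 0) + c)) := by
    refine (quasiMeasurePreserving_shear hF.continuous).ae (p := fun p : ℝ × ℝ =>
      DifferentiableAt ℝ R p ∧ ((∀ s t, R (s, p.2) = R (t, p.2)) ∨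
        fderiv ℝ R p (0, 1) + k = deriv F p.2 * (fderiv ℝ R p (1, 0) + c))) ?_
    filter_upwards [H, hR.ae_differentiableAt (μ := volume)] with p hp hd
    refine ⟨hd, hp.imp_right fun h => ?_⟩
    rwa [(hasDerivAt_slice_fst hd).deriv, (hasDerivAt_slice_snd hd).deriv] at h
  have H2 : ∀ᵐ x : ℝ, ∀ᵐ y : ℝ, DifferentiableAt ℝ R (x - F y, y) ∧
      ((∀ s t, R (s, y) = R (t, y)) ∨
        fderiv ℝ R (x - F y, y) (0, 1) + k
          = deriv F y * (fderiv ℝ R (x - F y, y) (1, 0) + c)) := by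
    have h2 : MeasurePreserving (Prod.swap : ℝ × ℝ → ℝ × ℝ) := Measure.measurePreserving_swap
    exact Measure.ae_ae_of_ae_prod (h2.quasiMeasurePreserving.ae H1)
  have hcomp : ∀ x, LipschitzWith (K * max L 1) fun y => R (x - F y, y) := fun x => by
    refine hR.comp (LipschitzWith.prodMk ?_ LipschitzWith.id)
    simpa using (LipschitzWith.const x).sub hF
  set S : Set ℝ := {x | ∀ᵐ y : ℝ, DifferentiableAt ℝ R (x - F y, y) ∧
      ((∀ s t, R (s, y) = R (t, y)) ∨
        fderiv ℝ R (x - F y, y) (0, 1) + k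
          = deriv F y * (fderiv ℝ R (x - F y, y) (1, 0) + c))} with hS
  have key : ∀ x ∈ S, ∀ b ∈ S, ∀ y, R (x - F y, y) = R (b - F y, y) := by
    intro x hx b hb y
    -- Along a characteristic `R` has derivative `F' c - k`, the same for all characteristics, so
    -- `D' = 0` where the equation holds; where the slice of `R` is constant, `D = 0` instead. In
    -- both cases `(D * D)' = 2 D D' = 0`, which is why the square is used.
    set D : ℝ → ℝ := fun y => R (x - F y, y) - R (b - F y, y) with hD
    have hac : AbsolutelyContinuousOnInterval (D * D) y₂ y := by
      have := (absolutelyContinuousOnInterval_of_lipschitz (hcomp x) y₂ y).sub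
        (absolutelyContinuousOnInterval_of_lipschitz (hcomp b) y₂ y)
      exact this.mul this
    obtain ⟨C, hC⟩ := hac.const_of_ae_hasDerivAt_zero (by
      filter_upwards [hx, hb, hF.ae_differentiableAt (μ := volume)] with y hx hb hFd _
      have hder : ∀ x, DifferentiableAt ℝ R (x - F y, y) →
          HasDerivAt (fun y => R (x - F y, y))
            (fderiv ℝ R (x - F y, y) (0, 1) - deriv F y * fderiv ℝ R (x - F y, y) (1, 0)) y := by
        intro x hd
        have h1 : HasDerivAt (fun y : ℝ => (x - F y, y)) (-deriv F y, (1 : ℝ)) y :=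
          (hFd.hasDerivAt.const_sub x).prodMk (hasDerivAt_id y)
        have h2 := hd.hasFDerivAt.comp_hasDerivAt (f := fun y : ℝ => (x - F y, y)) y h1
        have h3 : ((-deriv F y, (1 : ℝ)) : ℝ × ℝ) = (0, 1) - deriv F y • ((1, 0) : ℝ × ℝ) := by
          ext <;> simp
        rw [h3, map_sub, map_smul, smul_eq_mul] at h2
        exact h2
      have hDd := (hder x hx.1).sub (hder b hb.1)
      have hDD := hDd.mul hDd
      convert! hDD using 1
      rcases hx.2 with h0 | hx'
      · rw [Pi.sub_apply, h0 (x - F y) (b - F y)]; simp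
      rcases hb.2 with h0 | hb'
      · rw [Pi.sub_apply, h0 (x - F y) (b - F y)]; simp
      have : fderiv ℝ R (x - F y, y) (0, 1) - deriv F y * fderiv ℝ R (x - F y, y) (1, 0)
        - (fderiv ℝ R (b - F y, y) (0, 1) - deriv F y * fderiv ℝ R (b - F y, y) (1, 0)) = 0 := by
        linear_combination hx' - hb'
      rw [this]; simp)
    have h0 := hC y₂ left_mem_uIcc
    have h1 := hC y right_mem_uIcc
    have hD2 : D y₂ = 0 := by simp only [hD, hy₂ (x - F y₂) (b - F y₂), sub_self]
    rw [← h0, Pi.mul_apply, Pi.mul_apply, hD2, mul_zero, mul_self_eq_zero] at h1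
    exact sub_eq_zero.1 h1
  have hdense : Dense S := Measure.dense_of_ae H2
  obtain ⟨b, hb⟩ := hdense.nonempty
  have hall : (fun x => R (x - F y, y)) = fun _ => R (b - F y, y) := by
    refine Continuous.ext_on hdense ?_ continuous_const fun x hx => key x hx b hb y
    exact hR.continuous.comp (by fun_prop)
  have h1 := congrFun hall (s + F y)
  have h2 := congrFun hall (t + F y)
  simp only [add_sub_cancel_right] at h1 h2
  rw [h1, h2]

/-- If `R(x, y)` depends on `x` and `P(y, z)` on `z`, then `P` does not depend on `y`. -/
lemma fst_const_of_not_const {P Q R : ℝ × ℝ → ℝ} {KP KR : NNReal} (hP : LipschitzWith KP P)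
    (hR : LipschitzWith KR R) {c₁ c₂ c₃ : ℝ}
    (H : ∀ᵐ q : ℝ × ℝ × ℝ,
      deriv (fun s => Q (s, q.2.1)) q.1 + deriv (fun s => R (q.2.1, s)) q.2.2 + c₁ =
        (deriv (fun s => R (s, q.2.2)) q.2.1 + deriv (fun s => P (q.2.2, s)) q.1 + c₂) *
        (deriv (fun s => P (s, q.1)) q.2.2 + deriv (fun s => Q (q.1, s)) q.2.1 + c₃))
    (hy : ∀ y, (∀ s t, P (y, s) = P (y, t)) ∨ (∀ s t, R (s, y) = R (t, y)))
    (hz : ∀ z, (∀ s t, P (s, z) = P (t, z)) ∨ (∀ s t, Q (z, s) = Q (z, t)))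
    (hRx : ¬ ∀ y s t, R (s, y) = R (t, y)) (hPz : ¬ ∀ y s t, P (y, s) = P (y, t)) (z s t : ℝ) :
    P (s, z) = P (t, z) := by
  by_contra hPy
  push Not at hPz
  obtain ⟨y₂, r₁, r₂, hr⟩ := hPz
  have hy₂ : ∀ s t, R (s, y₂) = R (t, y₂) := (hy y₂).resolve_left fun h => hr (h r₁ r₂)
  -- For `z` in `Z` the slice `Q(z, ·)` is constant. Openness of `Z` gives it positive measure, and
  -- also lets this constancy be differentiated in `z`.
  set Z : Set ℝ := {z | ∀ s t, P (s, z) = P (t, z)}ᶜ with hZ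
  have hZo : IsOpen Z := (isClosed_setOf_forall_eq (f := fun z s => P (s, z))
        (hP.continuous.comp continuous_swap)).isOpen_compl
  have hZne : Z.Nonempty := ⟨z, fun h => hPy (h s t)⟩
  have hQZ : ∀ z ∈ Z, ∀ s t, Q (z, s) = Q (z, t) := fun z hz' => (hz z).resolve_left hz'
  have hfreq : ∃ᵐ z, z ∈ Z := by
    rw [frequently_ae_mem_iff]
    exact (hZo.measure_pos volume hZne).ne'
  obtain ⟨z₁, hz₁, hH⟩ := (hfreq.and_eventually (Measure.ae_ae_of_ae_prod H)).exists
  -- At `z₁` the term `Q_x` vanishes and `Q_z` does not depend on `x`; wherever `R(·, y)` is not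
  -- constant, `P_z` vanishes too. The product relation becomes `R_y + k = (P_y + c₃) (R_x + c₂)`, a
  -- transport equation with speed `F' = P_y + c₃`.
  refine hRx (slice_const_of_transport (F := fun y => P (y, z₁) + c₃ * y) (c := c₂)
    (k := deriv (fun s => Q (s, 0)) z₁ + c₁) hR
    ((lipschitz_slice_fst hP z₁).add (lipschitzWith_smul c₃)) ?_ hy₂)
  have hPd : ∀ᵐ p : ℝ × ℝ, DifferentiableAt ℝ (fun s => P (s, z₁)) p.2 :=
    Measure.quasiMeasurePreserving_snd.ae ((lipschitz_slice_fst hP z₁).ae_differentiableAt)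
  filter_upwards [hH, hPd] with p hp hd
  rcases hy p.2 with h | h
  · right
    have e1 : (fun s => P (p.2, s)) = fun _ => P (p.2, 0) := funext fun s => h s 0
    have e2 : (fun s => Q (z₁, s)) = fun _ => Q (z₁, 0) := funext fun s => hQZ z₁ hz₁ s 0
    have e3 : (fun s => Q (s, p.1)) =ᶠ[𝓝 z₁] fun s => Q (s, 0) := by
      filter_upwards [hZo.mem_nhds hz₁] with z hz using hQZ z hz _ _
    have e4 : deriv (fun y => P (y, z₁) + c₃ * y) p.2 = deriv (fun y => P (y, z₁)) p.2 + c₃ := by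
      have : HasDerivAt (fun y => P (y, z₁) + c₃ * y) (deriv (fun y => P (y, z₁)) p.2 + c₃ * 1)
          p.2 := hd.hasDerivAt.add ((hasDerivAt_id p.2).const_mul c₃)
      rw [this.deriv, mul_one]
    simp only [e1, e2, e3.deriv_eq, deriv_const] at hp
    rw [e4]
    linarith
  · exact Or.inl h

lemma ae_const_of_mul_mul_eq_one {f g h : ℝ → ℝ}
    (H : ∀ᵐ q : ℝ × ℝ × ℝ, f q.1 * g q.2.1 * h q.2.2 = 1) : ∃ c, ∀ᵐ z, h z = c := by
  obtain ⟨x, hx⟩ := (Measure.ae_ae_of_ae_prod H).exists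
  obtain ⟨y, hy⟩ := (Measure.ae_ae_of_ae_prod hx).exists
  refine ⟨(f x * g y)⁻¹, ?_⟩
  filter_upwards [hy] with z hz
  exact (inv_eq_of_mul_eq_one_right hz).symm

/-! ### Coordinates, mollification and weak derivatives -/

open Convolution ContinuousLinearMap

/-- The triple of coordinates, permuted by `σ`. -/
def coords (σ : Equiv.Perm (Fin 3)) : Space ≃ᵐ ℝ × ℝ × ℝ :=
  ((MeasurableEquiv.piCongrLeft (fun _ : Fin 3 => ℝ) σ).symm.trans
    (MeasurableEquiv.piFinSuccAbove (fun _ : Fin 3 => ℝ) 0)).trans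
    ((MeasurableEquiv.refl ℝ).prodCongr MeasurableEquiv.finTwoArrow)

lemma coords_apply (σ : Equiv.Perm (Fin 3)) (x : Space) :
    coords σ x = (x (σ 0), x (σ 1), x (σ 2)) := by
  rfl

lemma measurePreserving_coords (σ : Equiv.Perm (Fin 3)) : MeasurePreserving (coords σ) := by
  have h1 := (volume_measurePreserving_piCongrLeft (fun _ : Fin 3 => ℝ) σ).symm
  have h2 := volume_preserving_piFinSuccAbove (fun _ : Fin 3 => ℝ) 0
  have h3 := (MeasurePreserving.id (volume : Measure ℝ)).prod (volume_preserving_finTwoArrow ℝ)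
  exact h3.comp (h2.comp h1)

/-- The permutation `(0, 1, 2) ↦ (i, j, k)`. -/
lemma exists_perm {i j k : Fin 3} (hij : i ≠ j) (hik : i ≠ k) (hjk : j ≠ k) :
    ∃ σ : Equiv.Perm (Fin 3), σ 0 = i ∧ σ 1 = j ∧ σ 2 = k := by
  revert i j k
  decide

/-- Moves almost-everywhere statements between space and an iterated product, in the order of
variables that Fubini requires. -/
lemma ae_triple_iff {i j k : Fin 3} (hij : i ≠ j) (hik : i ≠ k) (hjk : j ≠ k)
    (p : ℝ × ℝ × ℝ → Prop) : (∀ᵐ x : Space, p (x i, x j, x k)) ↔ ∀ᵐ q, p q := by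
  obtain ⟨σ, rfl, rfl, rfl⟩ := exists_perm hij hik hjk
  constructor
  · intro h
    have := (measurePreserving_coords σ).symm.quasiMeasurePreserving.ae h
    filter_upwards [this] with q hq
    rw [← coords_apply, MeasurableEquiv.apply_symm_apply] at hq
    exact hq
  · intro h
    exact (measurePreserving_coords σ).quasiMeasurePreserving.ae h

lemma quasiMeasurePreserving_const_sub (x : Space) :
    Measure.QuasiMeasurePreserving fun t : Space => x - t :=
  quasiMeasurePreserving_sub_left volume x

lemma ae_comp_add {p : Space → Prop} (h : ∀ᵐ x, p x) (v : Space) : ∀ᵐ x, p (x + v) :=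
  (measurePreserving_add_right volume v).quasiMeasurePreserving.ae h

lemma convolution_apply (φ f : Space → ℝ) (x : Space) :
    (φ ⋆[lsmul ℝ ℝ, volume] f) x = ∫ t, φ t * f (x - t) := rfl

lemma convolution_apply_swap (φ f : Space → ℝ) (x : Space) :
    (φ ⋆[lsmul ℝ ℝ, volume] f) x = ∫ t, φ (x - t) * f t := by
  rw [convolution_eq_swap]; rfl

lemma convolution_congr_ae (φ : Space → ℝ) {f g : Space → ℝ} (h : f =ᵐ[volume] g) :
    φ ⋆[lsmul ℝ ℝ, volume] f = φ ⋆[lsmul ℝ ℝ, volume] g := by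
  funext x
  rw [convolution_apply_swap, convolution_apply_swap]
  refine integral_congr_ae ?_
  filter_upwards [h] with t ht
  rw [ht]

lemma contDiff_convolution {φ f : Space → ℝ} (hφ : ContDiff ℝ ∞ φ) (hc : HasCompactSupport φ)
    (hf : LocallyIntegrable f) : ContDiff ℝ ∞ (φ ⋆[lsmul ℝ ℝ, volume] f) :=
  hc.contDiff_convolution_left (lsmul ℝ ℝ) hφ hf

lemma fderiv_convolution {φ f : Space → ℝ} (hφ : ContDiff ℝ ∞ φ) (hc : HasCompactSupport φ)
    (hf : LocallyIntegrable f) (x v : Space) :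
    fderiv ℝ (φ ⋆[lsmul ℝ ℝ, volume] f) x v = ∫ t, fderiv ℝ φ (x - t) v * f t := by
  have hφ1 : ContDiff ℝ 1 φ := hφ.of_le (by exact_mod_cast le_top)
  rw [← convolution_flip, (hc.hasFDerivAt_convolution_right (lsmul ℝ ℝ).flip hf hφ1 x).fderiv,
    convolution_precompR_apply _ hf (hc.fderiv ℝ) (hφ1.continuous_fderiv one_ne_zero)]
  rfl

lemma fderiv_comp_const_sub_apply {φ : Space → ℝ} (hφ : Differentiable ℝ φ) (x t v : Space) :
    fderiv ℝ (fun t => φ (x - t)) t v = - fderiv ℝ φ (x - t) v := by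
  have h := (hφ (x - t)).hasFDerivAt.comp t ((hasFDerivAt_id t).const_sub x)
  have h' : HasFDerivAt (fun t => φ (x - t)) ((fderiv ℝ φ (x - t)).comp
    (-ContinuousLinearMap.id ℝ Space)) t := h
  rw [h'.fderiv]
  simp

lemma hasCompactSupport_comp_const_sub {φ : Space → ℝ} (hc : HasCompactSupport φ) (x : Space) :
    HasCompactSupport fun t => φ (x - t) :=
  hc.comp_homeomorph (Homeomorph.subLeft x)

lemma HasWeakPartial.fderiv_convolution {i : Fin 3} {f g φ : Space → ℝ}
    (h : HasWeakPartial i f g) (hφ : ContDiff ℝ ∞ φ) (hc : HasCompactSupport φ) (x : Space) :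
    fderiv ℝ (φ ⋆[lsmul ℝ ℝ, volume] f) x (unitVec i) = (φ ⋆[lsmul ℝ ℝ, volume] g) x := by
  have h1 := h.2.2 (fun t => φ (x - t)) (hφ.comp (contDiff_const.sub contDiff_id))
    (hasCompactSupport_comp_const_sub hc x)
  simp only [fderiv_comp_const_sub_apply (hφ.differentiable (by simp)), mul_neg, integral_neg, neg_inj] at h1
  rw [CubicTrigonal.fderiv_convolution hφ hc h.1, convolution_apply_swap]
  simpa only [mul_comm] using h1

lemma convolution_add_of_ae_eq (φ : Space → ℝ) {f : Space → ℝ} {v : Space}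
    (h : ∀ᵐ x, f (x + v) = f x) (x : Space) :
    (φ ⋆[lsmul ℝ ℝ, volume] f) (x + v) = (φ ⋆[lsmul ℝ ℝ, volume] f) x := by
  rw [convolution_apply, convolution_apply]
  refine integral_congr_ae ?_
  filter_upwards [(quasiMeasurePreserving_const_sub x).ae h] with t ht
  rw [← ht, sub_add_eq_add_sub]

lemma exists_mollifier : ∃ φ : ℕ → Space → ℝ, (∀ n, ContDiff ℝ ∞ (φ n)) ∧
    (∀ n, HasCompactSupport (φ n)) ∧ (∀ n x, 0 ≤ φ n x) ∧ (∀ n, ∫ x, φ n x = 1) ∧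
    ∀ f : Space → ℝ, LocallyIntegrable f →
      ∀ᵐ x, Tendsto (fun n => (φ n ⋆[lsmul ℝ ℝ, volume] f) x) atTop (𝓝 (f x)) := by
  let b : ℕ → ContDiffBump (0 : Space) := fun n =>
    ⟨1 / (n + 1 : ℝ), 2 * (1 / (n + 1 : ℝ)), by positivity, by
      have : (0 : ℝ) < 1 / (n + 1 : ℝ) := by positivity
      linarith⟩
  refine ⟨fun n => (b n).normed volume, fun n => (b n).contDiff_normed,
    fun n => (b n).hasCompactSupport_normed, fun n x => (b n).nonneg_normed x,
    fun n => (b n).integral_normed, fun f hf => ?_⟩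
  -- The outer radius is twice the inner one; this bounded ratio is what gives convergence almost
  -- everywhere.
  refine ContDiffBump.ae_convolution_tendsto_right_of_locallyIntegrable (K := 2) ?_ ?_ hf
  · have := (tendsto_one_div_add_atTop_nhds_zero_nat (𝕜 := ℝ)).const_mul 2
    rwa [mul_zero] at this
  · exact Eventually.of_forall fun n => le_rfl

lemma eq_add_smul_of_fderiv_eq_zero {f : Space → ℝ} (hf : Differentiable ℝ f) {v : Space}
    (h : ∀ x, fderiv ℝ f x v = 0) (x : Space) (s : ℝ) : f (x + s • v) = f x := by
  have hd : ∀ t : ℝ, HasDerivAt (fun t : ℝ => f (x + t • v)) 0 t := fun t => by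
    have h1 : HasDerivAt (fun t : ℝ => x + t • v) v t := by
      simpa using ((hasDerivAt_id t).smul_const v).const_add x
    have := (hf (x + t • v)).hasFDerivAt.comp_hasDerivAt t h1
    rwa [h] at this
  have := is_const_of_deriv_eq_zero (fun t => (hd t).differentiableAt) (fun t => (hd t).deriv) s 0
  simpa using this

/-- The mollifications have vanishing classical derivative in the direction, so they are exactly
invariant; invariance passes to the limit. -/
lemma HasWeakPartial.ae_eq_add {i : Fin 3} {f : Space → ℝ} (h : HasWeakPartial i f fun _ => 0)
    (s : ℝ) : ∀ᵐ x, f (x + s • unitVec i) = f x := by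
  obtain ⟨φ, hφ, hc, -, -, hlim⟩ := exists_mollifier
  filter_upwards [hlim f h.1, ae_comp_add (hlim f h.1) (s • unitVec i)] with x hx hx'
  refine tendsto_nhds_unique hx' (hx.congr fun n => ?_)
  refine (eq_add_smul_of_fderiv_eq_zero ((contDiff_convolution (hφ n) (hc n) h.1).differentiable
    (by simp)) (fun y => ?_) x s).symm
  rw [h.fderiv_convolution (hφ n) (hc n), convolution_apply]
  simp

lemma hasWeakPartial_zero_of_ae_eq_add {i : Fin 3} {f : Space → ℝ} (hf : LocallyIntegrable f)
    (h : ∀ s : ℝ, ∀ᵐ x, f (x + s • unitVec i) = f x) : HasWeakPartial i f fun _ => 0 := by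
  refine ⟨hf, locallyIntegrable_const 0, fun φ hφ hc => ?_⟩
  -- With the reflected test function, the derivative of the convolution at the origin is, up to
  -- sign, the pairing of `f` with `∂_i φ`; the convolution is constant along the direction.
  have hψ : ContDiff ℝ ∞ fun t => φ (0 - t) := hφ.comp (contDiff_const.sub contDiff_id)
  have hψc := hasCompactSupport_comp_const_sub hc 0
  have h1 := CubicTrigonal.fderiv_convolution hψ hψc hf 0 (unitVec i)
  have h2 : fderiv ℝ ((fun t => φ (0 - t)) ⋆[lsmul ℝ ℝ, volume] f) 0 (unitVec i) = 0 := by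
    have hd : HasDerivAt (fun t : ℝ => ((fun t => φ (0 - t)) ⋆[lsmul ℝ ℝ, volume] f)
        ((0 : Space) + t • unitVec i))
        (fderiv ℝ ((fun t => φ (0 - t)) ⋆[lsmul ℝ ℝ, volume] f) 0 (unitVec i)) 0 := by
      have h1 : HasDerivAt (fun t : ℝ => (0 : Space) + t • unitVec i) (unitVec i) 0 := by
        simpa using ((hasDerivAt_id (0 : ℝ)).smul_const (unitVec i)).const_add (0 : Space)
      have hd := ((contDiff_convolution hψ hψc hf).differentiable (by simp)) (0 + (0 : ℝ) • unitVec i)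
      have := hd.hasFDerivAt.comp_hasDerivAt 0 h1
      rw [zero_smul, add_zero] at this
      exact this
    have hconst : (fun t : ℝ => ((fun t => φ (0 - t)) ⋆[lsmul ℝ ℝ, volume] f)
        ((0 : Space) + t • unitVec i)) = fun _ => ((fun t => φ (0 - t)) ⋆[lsmul ℝ ℝ, volume] f) 0 :=
      funext fun t => convolution_add_of_ae_eq _ (h t) 0
    rw [hconst] at hd
    exact hd.unique (hasDerivAt_const _ _)
  rw [h2] at h1
  simp only [fderiv_comp_const_sub_apply (hφ.differentiable (by simp)), neg_mul, integral_neg, sub_sub_cancel] at h1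
  simp only [zero_mul, integral_zero, neg_zero]
  simpa [mul_comm] using h1.symm

/-! ### Cyclic indices and the four wells -/

lemma fin_add_one_one (k : Fin 3) : k + 1 + 1 = k + 2 := by revert k; decide
lemma fin_add_one_two (k : Fin 3) : k + 1 + 2 = k := by revert k; decide
lemma fin_add_two_one (k : Fin 3) : k + 2 + 1 = k := by revert k; decide
lemma fin_add_two_two (k : Fin 3) : k + 2 + 2 = k + 1 := by revert k; decide
lemma fin_ne_add_one (k : Fin 3) : k ≠ k + 1 := by revert k; decide
lemma fin_ne_add_two (k : Fin 3) : k ≠ k + 2 := by revert k; decide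
lemma fin_add_one_ne_add_two (k : Fin 3) : k + 1 ≠ k + 2 := by revert k; decide

lemma forall_fin_iff_cyclic {p : Fin 3 → Prop} (k : Fin 3) :
    (∀ a, p a) ↔ p k ∧ p (k + 1) ∧ p (k + 2) := by
  constructor
  · exact fun h => ⟨h _, h _, h _⟩
  · rintro ⟨h0, h1, h2⟩ a
    have : ∀ k a : Fin 3, a = k ∨ a = k + 1 ∨ a = k + 2 := by decide
    rcases this k a with rfl | rfl | rfl <;> assumption

section Wells

variable {d : Fin 3 → ℝ} {M : Mat}

lemma wells_offDiag (h : M ∈ wells d) (k : Fin 3) : M k (k + 1) = 1 ∨ M k (k + 1) = -1 := by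
  rcases h with rfl | rfl | rfl | rfl <;> fin_cases k <;> simp

/-- The rigidity of the potentials uses the wells only through this sign rule and `wells_offDiag`.
-/
lemma wells_mul (h : M ∈ wells d) (k : Fin 3) :
    M k (k + 1) = M (k + 1) (k + 2) * M (k + 2) k := by
  rcases h with rfl | rfl | rfl | rfl <;> fin_cases k <;> simp

lemma wells_symm (h : M ∈ wells d) (a b : Fin 3) : M a b = M b a := by
  rcases h with rfl | rfl | rfl | rfl <;> fin_cases a <;> fin_cases b <;> simp

lemma wells_diag (h : M ∈ wells d) (a : Fin 3) : M a a = d a := by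
  rcases h with rfl | rfl | rfl | rfl <;> fin_cases a <;> simp

lemma wells_abs_le (h : M ∈ wells d) {a b : Fin 3} (hab : a ≠ b) : |M a b| ≤ 1 := by
  rcases h with rfl | rfl | rfl | rfl <;> fin_cases a <;> fin_cases b <;> simp at hab ⊢

end Wells

/-! ### Rigidity of the strain potentials -/

/-- A periodic Lipschitz function whose first partial derivative is invariant under translations
of the first variable is independent of the first variable. -/
lemma fst_const_of_ae_deriv_eq_add {P : ℝ × ℝ → ℝ} {K : NNReal} (hP : LipschitzWith K P) {T : ℝ}
    (hT : T ≠ 0) (hper : ∀ s t, P (s + T, t) = P (s, t))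
    (H : ∀ s : ℝ, ∀ᵐ q : ℝ × ℝ × ℝ, dFst P (q.2.1 + s) q.1 = dFst P q.2.1 q.1) (s t z : ℝ) :
    P (s, z) = P (t, z) := by
  have key : ∀ s z y, P (y + s, z) - P (y, z) = P (s, z) - P (0, z) := by
    intro s z y
    have hcl := isClosed_setOf_forall_eq (f := fun z y => P (y + s, z) - P (y, z))
      ((hP.continuous.comp (by fun_prop)).sub (hP.continuous.comp (by fun_prop)))
    have hae : ∀ᵐ z, z ∈ {z | ∀ y t, P (y + s, z) - P (y, z) = P (t + s, z) - P (t, z)} := by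
      filter_upwards [Measure.ae_ae_of_ae_prod (H s)] with z hz
      have hz' : ∀ᵐ y, dFst P (y + s) z = dFst P y z := by
        filter_upwards [Measure.ae_ae_of_ae_prod hz] with y hy using hy.exists.choose_spec
      have hsl := lipschitz_slice_fst hP z
      have hsh : LipschitzWith K fun y => P (y + s, z) := by
        have := hsl.comp (LipschitzWith.id.add (LipschitzWith.const s))
        rwa [add_zero, mul_one] at this
      have hd : ∀ᵐ y, deriv (fun y => P (y + s, z) - P (y, z)) y = 0 := by
        filter_upwards [hz', hsl.ae_differentiableAt (μ := volume),
          hsh.ae_differentiableAt (μ := volume)] with y hy h1 h2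
        have h3 : deriv (fun y => P (y + s, z)) y = deriv (fun y => P (y, z)) (y + s) :=
          deriv_comp_add_const (fun y => P (y, z)) s y
        have h4 : HasDerivAt (fun y => P (y + s, z) - P (y, z)) _ y :=
          h2.hasDerivAt.sub h1.hasDerivAt
        rw [h4.deriv, h3]
        exact sub_eq_zero.2 hy
      intro y t
      have := lipschitz_sub_eq_of_ae_deriv_eq (hsh.sub hsl) hd t y
      rw [zero_mul] at this
      linarith
    have := forall_of_ae_of_isClosed hcl hae z y 0
    simpa using this
  -- Increments of `P(·, z)` depend only on the step, so the increment from 0 is additive and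
  -- continuous, hence linear; periodicity kills its slope.
  let a : ℝ →+ ℝ := AddMonoidHom.mk' (fun y => P (y, z) - P (0, z)) fun x y => by
    have := key y z x
    linarith
  have ha : Continuous a := by
    change Continuous fun y => P (y, z) - P (0, z)
    exact (lipschitz_slice_fst hP z).continuous.sub continuous_const
  have hlin : ∀ y, a y = y * a 1 := fun y => by
    simpa using map_real_smul a ha y 1
  have hT0 : a T = 0 := by
    change P (T, z) - P (0, z) = 0
    rw [← hper 0 z, zero_add, sub_self]
  have h1 : a 1 = 0 := by
    rw [hlin] at hT0
    exact (mul_eq_zero.1 hT0).resolve_left hT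
  have hs : P (s, z) - P (0, z) = 0 := (hlin s).trans (by rw [h1, mul_zero])
  have ht : P (t, z) - P (0, z) = 0 := (hlin t).trans (by rw [h1, mul_zero])
  linarith

lemma lipschitzWith_comp_swap {P : ℝ × ℝ → ℝ} {K : NNReal} (hP : LipschitzWith K P) :
    LipschitzWith K fun p : ℝ × ℝ => P (p.2, p.1) := by
  have h : LipschitzWith 1 fun p : ℝ × ℝ => (p.2, p.1) := by
    simpa using LipschitzWith.prod_snd.prodMk LipschitzWith.prod_fst
  have := hP.comp h
  rwa [mul_one] at this

section Potentials

variable {ℓ d : Fin 3 → ℝ} {e : Space → Mat} {Ψ : Fin 3 → ℝ × ℝ → ℝ}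

/-- The variable shared by the two potentials is `x (k + 1)`; with it frozen, the entry `(k + 2, k)`
is a sum of a function of `x k` and one of `x (k + 2)`. -/
lemma slice_const_or (hℓ : ∀ i, 0 < ℓ i) (he : ∀ᵐ x, e x ∈ wells d)
    (hΨ : IsStrainPotential ℓ e Ψ) (k : Fin 3) (z : ℝ) :
    (∀ s t, Ψ k (s, z) = Ψ k (t, z)) ∨ (∀ s t, Ψ (k + 1) (z, s) = Ψ (k + 1) (z, t)) := by
  obtain ⟨K, hK⟩ := hΨ.lipschitz k
  obtain ⟨L, hL⟩ := hΨ.lipschitz (k + 1)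
  refine slice_const_or_slice_const hK hL (hℓ k).ne' (hℓ (k + 1 + 1)).ne' (hΨ.periodic_fst k)
    (hΨ.periodic_snd (k + 1)) (c := avg ℓ e (k + 2) k) ?_ z
  rw [← ae_triple_iff (fin_add_one_ne_add_two k) (fin_ne_add_one k).symm (fin_ne_add_two k).symm]
  have hdec := hΨ.decomposition (k + 2)
  simp only [fin_add_two_one, fin_add_two_two] at hdec
  filter_upwards [hdec, he] with x hx hw
  have := wells_offDiag hw (k + 2)
  rw [fin_add_two_one, hx] at this
  exact this

lemma fst_const_succ (hℓ : ∀ i, 0 < ℓ i) (he : ∀ᵐ x, e x ∈ wells d)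
    (hΨ : IsStrainPotential ℓ e Ψ) (k : Fin 3) (hA : ¬ ∀ y s t, Ψ k (s, y) = Ψ k (t, y))
    (hB : ¬ ∀ y s t, Ψ (k + 1) (y, s) = Ψ (k + 1) (y, t)) (z s t : ℝ) :
    Ψ (k + 1) (s, z) = Ψ (k + 1) (t, z) := by
  obtain ⟨KR, hR⟩ := hΨ.lipschitz k
  obtain ⟨KP, hP⟩ := hΨ.lipschitz (k + 1)
  refine fst_const_of_not_const (Q := Ψ (k + 2)) (c₁ := avg ℓ e (k + 1) (k + 2))
    (c₂ := avg ℓ e (k + 2) k) (c₃ := avg ℓ e k (k + 1)) hP hR ?_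
    (fun y => (slice_const_or hℓ he hΨ k y).symm) (fun z => ?_) hA hB z s t
  · rw [← ae_triple_iff (fin_ne_add_two k).symm (fin_add_one_ne_add_two k).symm (fin_ne_add_one k)]
    have hdec0 := hΨ.decomposition k
    have hdec1 := hΨ.decomposition (k + 1)
    have hdec2 := hΨ.decomposition (k + 2)
    simp only [fin_add_two_one, fin_add_two_two, fin_add_one_one, fin_add_one_two]
      at hdec0 hdec1 hdec2
    filter_upwards [hdec0, hdec1, hdec2, he] with x h0 h1 h2 hw
    have := wells_mul hw (k + 1)
    simp only [fin_add_one_one, fin_add_one_two] at this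
    rw [h0, h1, h2] at this
    exact this
  · simpa only [fin_add_one_one] using slice_const_or hℓ he hΨ (k + 1) z

/-- Mirror image of `fst_const_succ`: reversing the cyclic order swaps the arguments of every
potential and the roles of `Ψ k` and `Ψ (k + 2)`. -/
lemma snd_const_succ (hℓ : ∀ i, 0 < ℓ i) (he : ∀ᵐ x, e x ∈ wells d)
    (hΨ : IsStrainPotential ℓ e Ψ) (k : Fin 3)
    (hB : ¬ ∀ y s t, Ψ (k + 2) (y, s) = Ψ (k + 2) (y, t))
    (hA : ¬ ∀ y s t, Ψ (k + 1) (s, y) = Ψ (k + 1) (t, y)) (z s t : ℝ) :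
    Ψ (k + 1) (z, s) = Ψ (k + 1) (z, t) := by
  obtain ⟨KR, hR⟩ := hΨ.lipschitz (k + 2)
  obtain ⟨KP, hP⟩ := hΨ.lipschitz (k + 1)
  refine fst_const_of_not_const (P := fun p => Ψ (k + 1) (p.2, p.1))
    (R := fun p => Ψ (k + 2) (p.2, p.1)) (Q := fun p => Ψ k (p.2, p.1))
    (c₁ := avg ℓ e (k + 1) (k + 2))
    (c₂ := avg ℓ e k (k + 1)) (c₃ := avg ℓ e (k + 2) k)
    (lipschitzWith_comp_swap hP) (lipschitzWith_comp_swap hR) ?_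
    (fun y => ?_) (fun z => (slice_const_or hℓ he hΨ k z).symm) hB hA z s t
  · rw [← ae_triple_iff (fin_ne_add_one k).symm (fin_add_one_ne_add_two k) (fin_ne_add_two k)]
    have hdec0 := hΨ.decomposition k
    have hdec1 := hΨ.decomposition (k + 1)
    have hdec2 := hΨ.decomposition (k + 2)
    simp only [fin_add_two_one, fin_add_two_two, fin_add_one_one, fin_add_one_two]
      at hdec0 hdec1 hdec2
    filter_upwards [hdec0, hdec1, hdec2, he] with x h0 h1 h2 hw
    have := wells_mul hw (k + 1)
    simp only [fin_add_one_one, fin_add_one_two] at this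
    rw [h0, h1, h2] at this
    simp only [dFst, dSnd] at this
    linarith
  · simpa only [fin_add_one_one] using slice_const_or hℓ he hΨ (k + 1) y

lemma dSnd_eq_zero {P : ℝ × ℝ → ℝ} (h : ∀ y s t, P (y, s) = P (y, t)) (s t : ℝ) :
    dSnd P s t = 0 := by
  have : (fun t' => P (s, t')) = fun _ => P (s, 0) := funext fun t' => h _ _ _
  rw [dSnd, this, deriv_const]

lemma dFst_eq_zero {P : ℝ × ℝ → ℝ} (h : ∀ y s t, P (s, y) = P (t, y)) (s t : ℝ) :
    dFst P s t = 0 := by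
  have : (fun s' => P (s', t)) = fun _ => P (0, t) := funext fun t' => h _ _ _
  rw [dFst, this, deriv_const]

lemma dFst_congr_snd {P : ℝ × ℝ → ℝ} (h : ∀ y s t, P (y, s) = P (y, t)) (s t t' : ℝ) :
    dFst P s t = dFst P s t' := by
  have : (fun s' => P (s', t)) = fun s' => P (s', t') := funext fun s' => h _ _ _
  rw [dFst, dFst, this]

lemma dSnd_congr_fst {P : ℝ × ℝ → ℝ} (h : ∀ y s t, P (s, y) = P (t, y)) (s s' t : ℝ) :
    dSnd P s t = dSnd P s' t := by
  have : (fun t' => P (s, t')) = fun t' => P (s', t') := funext fun t' => h _ _ _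
  rw [dSnd, dSnd, this]

/-- Each off-diagonal strain then depends on a single variable, a different one for each; as their
product is 1, each is constant, and periodicity removes the slope. -/
lemma fst_const_of_forall_snd_const (hℓ : ∀ i, 0 < ℓ i) (he : ∀ᵐ x, e x ∈ wells d)
    (hΨ : IsStrainPotential ℓ e Ψ) (hB : ∀ k y s t, Ψ k (y, s) = Ψ k (y, t)) (y s t : ℝ) :
    Ψ 0 (s, y) = Ψ 0 (t, y) := by
  have H : ∀ᵐ q : ℝ × ℝ × ℝ, (dFst (Ψ 1) q.1 0 + avg ℓ e 0 1) * (dFst (Ψ 2) q.2.1 0 + avg ℓ e 1 2)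
      * (dFst (Ψ 0) q.2.2 0 + avg ℓ e 2 0) = 1 := by
    rw [← ae_triple_iff (i := 1) (j := 2) (k := 0) (by decide) (by decide) (by decide)]
    filter_upwards [hΨ.decomposition 0, hΨ.decomposition 1, hΨ.decomposition 2, he]
      with x h0 h1 h2 hw
    have e0 : e x 0 1 = dFst (Ψ 1) (x 1) 0 + avg ℓ e 0 1 := by
      rw [dSnd_eq_zero (hB _), add_zero, dFst_congr_snd (hB _) _ _ 0] at h0
      exact h0
    have e1 : e x 1 2 = dFst (Ψ 2) (x 2) 0 + avg ℓ e 1 2 := by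
      rw [dSnd_eq_zero (hB _), add_zero, dFst_congr_snd (hB _) _ _ 0] at h1
      exact h1
    have e2 : e x 2 0 = dFst (Ψ 0) (x 0) 0 + avg ℓ e 2 0 := by
      rw [dSnd_eq_zero (hB _), add_zero, dFst_congr_snd (hB _) _ _ 0] at h2
      exact h2
    have hm : e x 0 1 = e x 1 2 * e x 2 0 := wells_mul hw 0
    have hs : e x 0 1 = 1 ∨ e x 0 1 = -1 := wells_offDiag hw 0
    rw [← e0, ← e1, ← e2, mul_assoc, ← hm]
    rcases hs with h | h <;> rw [h] <;> norm_num
  obtain ⟨c, hc⟩ := ae_const_of_mul_mul_eq_one (f := fun s => dFst (Ψ 1) s 0 + avg ℓ e 0 1)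
    (g := fun s => dFst (Ψ 2) s 0 + avg ℓ e 1 2) (h := fun s => dFst (Ψ 0) s 0 + avg ℓ e 2 0) H
  obtain ⟨K, hK⟩ := hΨ.lipschitz 0
  rw [hB 0 s y 0, hB 0 t y 0]
  refine eq_of_ae_deriv_eq_of_periodic (c := c - avg ℓ e 2 0) (lipschitz_slice_fst hK 0) (hℓ 0).ne'
    (fun t => hΨ.periodic_fst 0 t 0) ?_ s t
  filter_upwards [hc] with s hs
  exact eq_sub_of_add_eq hs

lemma snd_const_of_forall_fst_const (hℓ : ∀ i, 0 < ℓ i) (he : ∀ᵐ x, e x ∈ wells d)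
    (hΨ : IsStrainPotential ℓ e Ψ) (hA : ∀ k y s t, Ψ k (s, y) = Ψ k (t, y)) (y s t : ℝ) :
    Ψ 1 (y, s) = Ψ 1 (y, t) := by
  have H : ∀ᵐ q : ℝ × ℝ × ℝ, (dSnd (Ψ 2) 0 q.1 + avg ℓ e 0 1) * (dSnd (Ψ 0) 0 q.2.1 + avg ℓ e 1 2)
      * (dSnd (Ψ 1) 0 q.2.2 + avg ℓ e 2 0) = 1 := by
    rw [← ae_triple_iff (i := 0) (j := 1) (k := 2) (by decide) (by decide) (by decide)]
    filter_upwards [hΨ.decomposition 0, hΨ.decomposition 1, hΨ.decomposition 2, he]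
      with x h0 h1 h2 hw
    have e0 : e x 0 1 = dSnd (Ψ 2) 0 (x 0) + avg ℓ e 0 1 := by
      rw [dFst_eq_zero (hA _), zero_add (dSnd _ _ _), dSnd_congr_fst (hA _) _ 0] at h0
      exact h0
    have e1 : e x 1 2 = dSnd (Ψ 0) 0 (x 1) + avg ℓ e 1 2 := by
      rw [dFst_eq_zero (hA _), zero_add (dSnd _ _ _), dSnd_congr_fst (hA _) _ 0] at h1
      exact h1
    have e2 : e x 2 0 = dSnd (Ψ 1) 0 (x 2) + avg ℓ e 2 0 := by
      rw [dFst_eq_zero (hA _), zero_add (dSnd _ _ _), dSnd_congr_fst (hA _) _ 0] at h2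
      exact h2
    have hm : e x 0 1 = e x 1 2 * e x 2 0 := wells_mul hw 0
    have hs : e x 0 1 = 1 ∨ e x 0 1 = -1 := wells_offDiag hw 0
    rw [← e0, ← e1, ← e2, mul_assoc, ← hm]
    rcases hs with h | h <;> rw [h] <;> norm_num
  obtain ⟨c, hc⟩ := ae_const_of_mul_mul_eq_one (f := fun s => dSnd (Ψ 2) 0 s + avg ℓ e 0 1)
    (g := fun s => dSnd (Ψ 0) 0 s + avg ℓ e 1 2) (h := fun s => dSnd (Ψ 1) 0 s + avg ℓ e 2 0) H
  obtain ⟨K, hK⟩ := hΨ.lipschitz 1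
  rw [hA 1 s y 0, hA 1 t y 0]
  refine eq_of_ae_deriv_eq_of_periodic (c := c - avg ℓ e 2 0) (lipschitz_slice_snd hK 0) (hℓ 2).ne'
    (fun t => hΨ.periodic_snd 1 0 t) ?_ s t
  filter_upwards [hc] with s hs
  exact eq_sub_of_add_eq hs

/-- Both potentials that involve some coordinate `x_i` are independent of it. -/
lemma exists_potentials_const (hℓ : ∀ i, 0 < ℓ i) (he : ∀ᵐ x, e x ∈ wells d)
    (hΨ : IsStrainPotential ℓ e Ψ) :
    ∃ i, (∀ y s t, Ψ i (s, y) = Ψ i (t, y)) ∧ ∀ y s t, Ψ (i + 2) (y, s) = Ψ (i + 2) (y, t) := by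
  set A : Fin 3 → Prop := fun i => ∀ y s t, Ψ i (s, y) = Ψ i (t, y) with hA
  set B : Fin 3 → Prop := fun i => ∀ y s t, Ψ i (y, s) = Ψ i (y, t) with hB
  change ∃ i, A i ∧ B (i + 2)
  have h1 : ∀ k, ¬ A k → ¬ B (k + 1) → A (k + 1) := fun k => fst_const_succ hℓ he hΨ k
  have h2 : ∀ k, ¬ B (k + 2) → ¬ A (k + 1) → B (k + 1) := fun k => snd_const_succ hℓ he hΨ k
  have h3 : (∀ k, B k) → A 0 := fst_const_of_forall_snd_const hℓ he hΨ
  have h4 : (∀ k, A k) → B 1 := snd_const_of_forall_fst_const hℓ he hΨ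
  clear_value A B
  have a0 : ¬ A 0 → ¬ B 1 → A 1 := h1 0
  have a1 : ¬ A 1 → ¬ B 2 → A 2 := h1 1
  have a2 : ¬ A 2 → ¬ B 0 → A 0 := h1 2
  have b0 : ¬ B 2 → ¬ A 1 → B 1 := h2 0
  have b1 : ¬ B 0 → ¬ A 2 → B 2 := h2 1
  have b2 : ¬ B 1 → ¬ A 0 → B 0 := h2 2
  rw [Fin.forall_fin_succ, Fin.forall_fin_two] at h3 h4
  have h3' : B 0 ∧ B 1 ∧ B 2 → A 0 := h3
  have h4' : A 0 ∧ A 1 ∧ A 2 → B 1 := h4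
  by_contra hn
  have c0 : ¬ (A 0 ∧ B 2) := fun h => hn ⟨0, h⟩
  have c1 : ¬ (A 1 ∧ B 0) := fun h => hn ⟨1, h⟩
  have c2 : ¬ (A 2 ∧ B 1) := fun h => hn ⟨2, h⟩
  clear h1 h2 h3 h4 hn
  -- If `B k` fails, then `A (k + 2)` holds: otherwise `B (k + 2)` and `A k` follow, which is
  -- excluded. Then `B (k + 1)` fails by exclusion. Going round, every `A` holds and every `B`
  -- fails, against `h4'`. If no `B` fails, `h3'` gives `A 0` together with `B 2`.
  grind

lemma potentials_const_of_partialVanishes (hℓ : ∀ i, 0 < ℓ i)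
    (hΨ : IsStrainPotential ℓ e Ψ) {i : Fin 3} (hi : PartialVanishes i e) :
    (∀ y s t, Ψ i (s, y) = Ψ i (t, y)) ∧ ∀ y s t, Ψ (i + 2) (y, s) = Ψ (i + 2) (y, t) := by
  have hself : ∀ (x : Space) (s : ℝ), (x + s • unitVec i) i = x i + s := fun x s => by
    simp [unitVec]
  have hother : ∀ (x : Space) (s : ℝ) (j : Fin 3), j ≠ i → (x + s • unitVec i) j = x j :=
    fun x s j hj => by simp [unitVec, hj]
  constructor
  · intro y s t
    obtain ⟨K, hK⟩ := hΨ.lipschitz i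
    refine fst_const_of_ae_deriv_eq_add hK (hℓ i).ne' (hΨ.periodic_fst i) (fun s => ?_) s t y
    rw [← ae_triple_iff (fin_ne_add_one i).symm (fin_add_one_ne_add_two i) (fin_ne_add_two i)]
    have hdec := hΨ.decomposition (i + 2)
    simp only [fin_add_two_one, fin_add_two_two] at hdec
    filter_upwards [(hi (i + 2) i).ae_eq_add s, hdec, ae_comp_add hdec (s • unitVec i)]
      with x h1 h2 h3
    rw [hself, hother _ _ _ (fin_ne_add_one i).symm, hother _ _ _ (fin_ne_add_two i).symm] at h3
    linarith
  · intro y s t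
    obtain ⟨K, hK⟩ := hΨ.lipschitz (i + 2)
    refine fst_const_of_ae_deriv_eq_add (lipschitzWith_comp_swap hK) (hℓ (i + 2 + 1)).ne'
      (fun s t => hΨ.periodic_snd (i + 2) t s) (fun s => ?_) s t y
    rw [← ae_triple_iff (fin_ne_add_two i).symm (fin_add_one_ne_add_two i).symm (fin_ne_add_one i)]
    have hdec := hΨ.decomposition i
    filter_upwards [(hi i (i + 1)).ae_eq_add s, hdec, ae_comp_add hdec (s • unitVec i)]
      with x h1 h2 h3
    rw [hself, hother _ _ _ (fin_ne_add_one i).symm, hother _ _ _ (fin_ne_add_two i).symm] at h3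
    change dSnd (Ψ (i + 2)) (x (i + 2)) (x i + s) = dSnd (Ψ (i + 2)) (x (i + 2)) (x i)
    linarith

lemma decompositions_of_potentials_const (hℓ : ∀ i, 0 < ℓ i) (he : ∀ᵐ x, e x ∈ wells d)
    (hΨ : IsStrainPotential ℓ e Ψ) {i : Fin 3} (hA : ∀ y s t, Ψ i (s, y) = Ψ i (t, y))
    (hB : ∀ y s t, Ψ (i + 2) (y, s) = Ψ (i + 2) (y, t)) :
    DecompositionOne ℓ e Ψ i ∨ DecompositionTwo ℓ e Ψ i := by
  have hdec0 := hΨ.decomposition i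
  have hdec1 := hΨ.decomposition (i + 1)
  have hdec2 := hΨ.decomposition (i + 2)
  simp only [fin_add_two_one, fin_add_two_two, fin_add_one_one, fin_add_one_two]
    at hdec0 hdec1 hdec2
  have hcommon : CommonPart ℓ e Ψ i := by
    constructor
    · filter_upwards [hdec2] with x hx
      rw [hx, dFst_eq_zero hA, zero_add]
    · filter_upwards [hdec0] with x hx
      rw [hx, dSnd_eq_zero hB, add_zero]
  -- The slice at `x i = 0` suffices, since by `hA` and `hB` every slice coincides with it.
  have hdich := slice_const_or hℓ he hΨ (i + 2) 0
  rw [fin_add_two_one] at hdich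
  rcases hdich with h | h
  · refine Or.inl ⟨hcommon, fun t => Ψ i (0, t), fun s t => hA t s 0, ?_⟩
    have hA2 : ∀ y s t, Ψ (i + 2) (s, y) = Ψ (i + 2) (t, y) := fun y s t => by
      rw [hB s y 0, hB t y 0, h s t]
    filter_upwards [hdec1] with x hx
    rw [hx, dFst_eq_zero hA2, zero_add, dSnd_congr_fst hA _ 0]
    rfl
  · refine Or.inr ⟨hcommon, fun s => Ψ (i + 2) (s, 0), fun s t => hB s t 0, ?_⟩
    have hB0 : ∀ y s t, Ψ i (y, s) = Ψ i (y, t) := fun y s t => by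
      rw [hA s y 0, hA t y 0, h s t]
    filter_upwards [hdec1] with x hx
    rw [hx, dSnd_eq_zero hB0, add_zero, dFst_congr_snd hB _ _ 0]
    rfl

lemma partialVanishes_of_potentials_const (he : ∀ᵐ x, e x ∈ wells d)
    (hint : ∀ a b, LocallyIntegrable fun x => e x a b)
    (hΨ : IsStrainPotential ℓ e Ψ) {i : Fin 3} (hA : ∀ y s t, Ψ i (s, y) = Ψ i (t, y))
    (hB : ∀ y s t, Ψ (i + 2) (y, s) = Ψ (i + 2) (y, t)) : PartialVanishes i e := by
  have hself : ∀ (x : Space) (s : ℝ), (x + s • unitVec i) i = x i + s := fun x s => by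
    simp [unitVec]
  have hother : ∀ (x : Space) (s : ℝ) (j : Fin 3), j ≠ i → (x + s • unitVec i) j = x j :=
    fun x s j hj => by simp [unitVec, hj]
  have hdec0 := hΨ.decomposition i
  have hdec1 := hΨ.decomposition (i + 1)
  have hdec2 := hΨ.decomposition (i + 2)
  simp only [fin_add_two_one, fin_add_two_two, fin_add_one_one, fin_add_one_two]
    at hdec0 hdec1 hdec2
  have hinv : ∀ s : ℝ, ∀ᵐ x, e (x + s • unitVec i) = e x := by
    intro s
    filter_upwards [hdec0, hdec1, hdec2, he, ae_comp_add hdec0 (s • unitVec i),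
      ae_comp_add hdec1 (s • unitVec i), ae_comp_add hdec2 (s • unitVec i),
      ae_comp_add he (s • unitVec i)] with x h0 h1 h2 hw h0' h1' h2' hw'
    rw [hself, hother _ _ _ (fin_ne_add_one i).symm, hother _ _ _ (fin_ne_add_two i).symm]
      at h0' h1' h2'
    have g0 : e (x + s • unitVec i) i (i + 1) = e x i (i + 1) := by
      rw [h0, h0', dSnd_eq_zero hB, dSnd_eq_zero hB]
    have g1 : e (x + s • unitVec i) (i + 1) (i + 2) = e x (i + 1) (i + 2) := by
      rw [h1, h1', dFst_congr_snd hB _ _ (x i), dSnd_congr_fst hA _ (x i)]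
    have g2 : e (x + s • unitVec i) (i + 2) i = e x (i + 2) i := by
      rw [h2, h2', dFst_eq_zero hA, dFst_eq_zero hA]
    have hd : ∀ a, e (x + s • unitVec i) a a = e x a a := fun a => by
      rw [wells_diag hw, wells_diag hw']
    ext a b
    revert a b
    simp only [forall_fin_iff_cyclic i]
    refine ⟨⟨hd _, g0, ?_⟩, ⟨?_, hd _, g1⟩, ⟨g2, ?_, hd _⟩⟩
    · rw [wells_symm hw, wells_symm hw', g2]
    · rw [wells_symm hw, wells_symm hw', g0]
    · rw [wells_symm hw, wells_symm hw', g1]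
  intro a b
  refine hasWeakPartial_zero_of_ae_eq_add (hint a b) fun s => ?_
  filter_upwards [hinv s] with x hx
  rw [hx]

end Potentials

/-! ### Smooth displacements with periodic strain -/

/-- The `b`-th partial derivative of a function on space. -/
def partialDeriv (b : Fin 3) (f : Space → ℝ) (x : Space) : ℝ := fderiv ℝ f x (unitVec b)

lemma eq_sum_smul_unitVec (v : Space) : v = ∑ i, v i • unitVec i := by
  ext j
  simp [unitVec, Finset.sum_apply, Pi.single_apply]

lemma contDiff_partialDeriv {f : Space → ℝ} (hf : ContDiff ℝ ∞ f) (b : Fin 3) :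
    ContDiff ℝ ∞ (partialDeriv b f) :=
  (hf.fderiv_right (m := ∞) (by simp)).clm_apply contDiff_const

lemma partialDeriv_comm {f : Space → ℝ} (hf : ContDiff ℝ ∞ f) (a b : Fin 3) (x : Space) :
    partialDeriv a (partialDeriv b f) x = partialDeriv b (partialDeriv a f) x := by
  have hd : DifferentiableAt ℝ (fderiv ℝ f) x :=
    (hf.fderiv_right (m := ∞) (by simp)).differentiable (by simp) x
  have h : ∀ v w, fderiv ℝ (fun y => fderiv ℝ f y v) x w = fderiv ℝ (fderiv ℝ f) x w v := by
    intro v w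
    rw [fderiv_clm_apply hd (differentiableAt_const v)]
    simp
  have hs : IsSymmSndFDerivAt ℝ f x :=
    hf.contDiffAt.isSymmSndFDerivAt (by
      rw [minSmoothness_of_isRCLikeNormedField]; exact WithTop.coe_le_coe.2 le_top)
  change fderiv ℝ (fun y => fderiv ℝ f y (unitVec b)) x (unitVec a) =
    fderiv ℝ (fun y => fderiv ℝ f y (unitVec a)) x (unitVec b)
  rw [h, h]
  exact hs _ _

lemma add_smul_of_fderiv_eq_const {f : Space → ℝ} (hf : Differentiable ℝ f) {v : Space} {c : ℝ}
    (h : ∀ x, fderiv ℝ f x v = c) (x : Space) (s : ℝ) : f (x + s • v) = f x + s * c := by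
  have hd : ∀ t : ℝ, HasDerivAt (fun t : ℝ => f (x + t • v) - t * c) 0 t := fun t => by
    have h1 : HasDerivAt (fun t : ℝ => x + t • v) v t := by
      simpa using ((hasDerivAt_id t).smul_const v).const_add x
    have h2 := (hf (x + t • v)).hasFDerivAt.comp_hasDerivAt t h1
    rw [h] at h2
    have h3 := h2.sub ((hasDerivAt_id t).mul_const c)
    rw [one_mul, sub_self] at h3
    exact h3
  have := is_const_of_deriv_eq_zero (fun t => (hd t).differentiableAt) (fun t => (hd t).deriv) s 0
  simp only [zero_smul, add_zero, zero_mul, sub_zero] at this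
  linarith

lemma eq_of_partialDeriv_eq_zero {f : Space → ℝ} (hf : Differentiable ℝ f)
    (h : ∀ a x, partialDeriv a f x = 0) (x y : Space) : f x = f y := by
  refine is_const_of_fderiv_eq_zero hf (fun x => ?_) x y
  ext v
  rw [eq_sum_smul_unitVec v, map_sum]
  simp only [map_smul]
  exact Finset.sum_eq_zero fun i _ => by
    have : fderiv ℝ f x (unitVec i) = 0 := h i x
    rw [this, smul_zero]

/-- A smooth displacement with vanishing symmetrized gradient has constant gradient. -/
lemma partialDeriv_eq_of_killing {W : Fin 3 → Space → ℝ} (hW : ∀ a, ContDiff ℝ ∞ (W a))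
    (h : ∀ a b x, partialDeriv b (W a) x + partialDeriv a (W b) x = 0) (a b : Fin 3)
    (x y : Space) : partialDeriv b (W a) x = partialDeriv b (W a) y := by
  refine eq_of_partialDeriv_eq_zero ((contDiff_partialDeriv (hW a) b).differentiable (by simp))
    (fun c z => ?_) x y
  have hanti : ∀ p q r, partialDeriv p (partialDeriv q (W r)) z
      = - partialDeriv p (partialDeriv r (W q)) z := by
    intro p q r
    have hq : partialDeriv q (W r) = fun x => - partialDeriv r (W q) x :=
      funext fun x => by linarith [h r q x]
    rw [hq, partialDeriv, fderiv_fun_neg]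
    rfl
  have hcomm : ∀ p q r, partialDeriv p (partialDeriv q (W r)) z
      = partialDeriv q (partialDeriv p (W r)) z := fun p q r => partialDeriv_comm (hW r) p q z
  -- The second derivatives `∂_p ∂_q W_r` are symmetric in `p, q` and skew in `q, r`. Alternating
  -- the two rules three times each returns to the start with sign `-1`.
  linarith [hanti c b a, hcomm c a b, hanti a c b, hcomm a b c, hanti b a c, hcomm b c a]

section Smooth

variable {ℓ d : Fin 3 → ℝ} {U : Fin 3 → Space → ℝ}

lemma partialDeriv_add_smul_self (hU : ∀ a, ContDiff ℝ ∞ (U a))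
    (hdiag : ∀ a x, partialDeriv a (U a) x = d a) (a b : Fin 3) (x : Space) (s : ℝ) :
    partialDeriv b (U a) (x + s • unitVec a) = partialDeriv b (U a) x := by
  refine eq_add_smul_of_fderiv_eq_zero
    ((contDiff_partialDeriv (hU a) b).differentiable (by simp)) (fun y => ?_) x s
  change partialDeriv a (partialDeriv b (U a)) y = 0
  have : partialDeriv a (U a) = fun _ => d a := funext (hdiag a)
  rw [partialDeriv_comm (hU a), this, partialDeriv]
  simp

/-- A smooth displacement with periodic symmetrized gradient and constant diagonal strains is
quasi-periodic: its increments over the periods are constant. -/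
lemma sub_eq_of_periodic_symmGradient (hℓ : ∀ i, 0 < ℓ i) (hU : ∀ a, ContDiff ℝ ∞ (U a))
    (hdiag : ∀ a x, partialDeriv a (U a) x = d a)
    (hper : ∀ j a b x, partialDeriv b (U a) (x + ℓ j • unitVec j) +
      partialDeriv a (U b) (x + ℓ j • unitVec j) = partialDeriv b (U a) x + partialDeriv a (U b) x)
    (a j : Fin 3) (x y : Space) :
    U a (x + ℓ j • unitVec j) - U a x = U a (y + ℓ j • unitVec j) - U a y := by
  set W : Fin 3 → Fin 3 → Space → ℝ := fun j a x => U a (x + ℓ j • unitVec j) - U a x with hWdef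
  have hW : ∀ j a, ContDiff ℝ ∞ (W j a) := fun j a =>
    ((hU a).comp (contDiff_id.add contDiff_const)).sub (hU a)
  have hWd : ∀ j a b x, partialDeriv b (W j a) x
      = partialDeriv b (U a) (x + ℓ j • unitVec j) - partialDeriv b (U a) x := by
    intro j a b x
    have hd : Differentiable ℝ (U a) := (hU a).differentiable (by simp)
    have h1 : DifferentiableAt ℝ (fun x => U a (x + ℓ j • unitVec j)) x :=
      ((hU a).comp (contDiff_id.add contDiff_const)).differentiable (by simp) x
    simp only [partialDeriv, hWdef]
    rw [fderiv_fun_sub h1 (hd x), fderiv_comp_add_right]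
    rfl
  have hK : ∀ j a b x, partialDeriv b (W j a) x = partialDeriv b (W j a) 0 := fun j a b x =>
    partialDeriv_eq_of_killing (hW j) (fun a b x => by
      rw [hWd, hWd]; linarith [hper j a b x]) a b x 0
  set β : Fin 3 → Fin 3 → Fin 3 → ℝ := fun j a b => partialDeriv b (W j a) 0 with hβ
  have hanti : ∀ j a b, β j a b = - β j b a := fun j a b => by
    simp only [hβ, hWd]; linarith [hper j a b 0]
  have hself : ∀ a b, β a a b = 0 := fun a b => by
    simp only [hβ, hWd, partialDeriv_add_smul_self hU hdiag, sub_self]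
  -- Both sides are the mixed second difference of `U a` over the periods `j` and `k`.
  have hcomm : ∀ j a k, ℓ k * β j a k = ℓ j * β k a j := by
    intro j a k
    have h1 := add_smul_of_fderiv_eq_const ((hW j a).differentiable (by simp)) (hK j a k) 0 (ℓ k)
    have h2 := add_smul_of_fderiv_eq_const ((hW k a).differentiable (by simp)) (hK k a j) 0 (ℓ j)
    have h3 : W j a (0 + ℓ k • unitVec k) - W j a 0 = W k a (0 + ℓ j • unitVec j) - W k a 0 := by
      simp only [hWdef, add_right_comm]
      ring
    have e1 : ℓ k * β j a k = W j a (0 + ℓ k • unitVec k) - W j a 0 := by rw [h1]; ring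
    have e2 : ℓ j * β k a j = W k a (0 + ℓ j • unitVec j) - W k a 0 := by rw [h2]; ring
    rw [e1, e2, h3]
  -- By `hself` and skewness only `γ j = β j (j + 1) (j + 2)` and its negative can survive.
  -- Commutation relates the three `γ` cyclically, with one sign change each, so going round gives
  -- `γ j = -γ j`.
  have hγ : ∀ j, β j (j + 1) (j + 2) = 0 := by
    intro j
    have h1 := hcomm j (j + 1) (j + 2)
    have h2 := hcomm (j + 2) j (j + 1)
    have h3 := hcomm (j + 1) (j + 2) j
    rw [hanti (j + 2) (j + 1) j] at h1
    rw [hanti (j + 1) j (j + 2)] at h2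
    rw [hanti j (j + 2) (j + 1)] at h3
    have h4 : 2 * (ℓ (j + 1) * ℓ (j + 2)) * β j (j + 1) (j + 2) = 0 := by
      linear_combination ℓ (j + 1) * h1 - ℓ j * h2 + ℓ (j + 2) * h3
    have := hℓ (j + 1)
    have := hℓ (j + 2)
    exact (mul_eq_zero.1 h4).resolve_left (by positivity)
  have hβ0 : ∀ j a b, β j a b = 0 := by
    intro j
    simp only [forall_fin_iff_cyclic j]
    have hd : ∀ a, β j a a = 0 := fun a => by linarith [hanti j a a]
    refine ⟨⟨hd _, hself _ _, hself _ _⟩, ⟨?_, hd _, hγ j⟩, ⟨?_, ?_, hd _⟩⟩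
    · rw [hanti, hself, neg_zero]
    · rw [hanti, hself, neg_zero]
    · rw [hanti, hγ, neg_zero]
  exact eq_of_partialDeriv_eq_zero ((hW j a).differentiable (by simp))
    (fun b z => (hK j a b z).trans (hβ0 j a b)) x y

/-- By the mean value theorem over one period in direction `a`, `∂_a U_b` equals its mean slope,
independent of `x`, at some point of the segment. Moving along that segment does not change `∂_b
U_a`, so the strain bound places `∂_b U_a` within 2 of a constant. -/
lemma abs_partialDeriv_sub_le (hℓ : ∀ i, 0 < ℓ i) (hU : ∀ a, ContDiff ℝ ∞ (U a))
    (hdiag : ∀ a x, partialDeriv a (U a) x = d a)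
    (hper : ∀ j a b x, partialDeriv b (U a) (x + ℓ j • unitVec j) +
      partialDeriv a (U b) (x + ℓ j • unitVec j) = partialDeriv b (U a) x + partialDeriv a (U b) x)
    (hbd : ∀ a b x, a ≠ b → |partialDeriv b (U a) x + partialDeriv a (U b) x| ≤ 2)
    (a b : Fin 3) (x y : Space) : |partialDeriv b (U a) x - partialDeriv b (U a) y| ≤ 4 := by
  rcases eq_or_ne a b with rfl | hab
  · simp [hdiag]
  have key : ∀ x, |partialDeriv b (U a) x + (U b (0 + ℓ a • unitVec a) - U b 0) / ℓ a| ≤ 2 := by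
    intro x
    have hder : ∀ s : ℝ, HasDerivAt (fun s : ℝ => U b (x + s • unitVec a))
        (partialDeriv a (U b) (x + s • unitVec a)) s := fun s => by
      have h1 : HasDerivAt (fun t : ℝ => x + t • unitVec a) (unitVec a) s := by
        simpa using ((hasDerivAt_id s).smul_const (unitVec a)).const_add x
      exact ((hU b).differentiable (by simp) _).hasFDerivAt.comp_hasDerivAt s h1
    obtain ⟨c, -, hc⟩ := exists_hasDerivAt_eq_slope _ _ (hℓ a)
      (continuous_iff_continuousAt.2 fun s => (hder s).continuousAt).continuousOn
      (fun s _ => hder s)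
    rw [zero_smul, add_zero, sub_zero, sub_eq_of_periodic_symmGradient hℓ hU hdiag hper b a x 0]
      at hc
    rw [← hc, ← partialDeriv_add_smul_self hU hdiag a b x c]
    exact hbd a b _ hab
  have h1 := abs_le.1 (key x)
  have h2 := abs_le.1 (key y)
  rw [abs_le]
  constructor <;> linarith [h1.1, h1.2, h2.1, h2.2]

end Smooth

/-! ### Lipschitz representative of the displacement -/

section Convolution

variable {φ : Space → ℝ}

lemma convolution_add_right (hφ : ContDiff ℝ ∞ φ) (hc : HasCompactSupport φ) {f g : Space → ℝ}
    (hf : LocallyIntegrable f) (hg : LocallyIntegrable g) (x : Space) :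
    (φ ⋆[lsmul ℝ ℝ, volume] fun x => f x + g x) x =
      (φ ⋆[lsmul ℝ ℝ, volume] f) x + (φ ⋆[lsmul ℝ ℝ, volume] g) x :=
  ConvolutionExistsAt.distrib_add
    (hc.convolutionExists_left (lsmul ℝ ℝ) hφ.continuous hf x)
    (hc.convolutionExists_left (lsmul ℝ ℝ) hφ.continuous hg x)

lemma abs_convolution_le (hφ : ContDiff ℝ ∞ φ) (hc : HasCompactSupport φ) (h0 : ∀ x, 0 ≤ φ x)
    (h1 : ∫ x, φ x = 1) {f : Space → ℝ} {C : ℝ} (hf : ∀ᵐ x, |f x| ≤ C) (x : Space) :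
    |(φ ⋆[lsmul ℝ ℝ, volume] f) x| ≤ C := by
  rw [convolution_apply]
  have hint : Integrable fun t => φ t * C :=
    (hφ.continuous.integrable_of_hasCompactSupport hc).mul_const C
  have := norm_integral_le_of_norm_le (f := fun t => φ t * f (x - t)) hint (by
    filter_upwards [(quasiMeasurePreserving_const_sub x).ae hf] with t ht
    rw [norm_mul, Real.norm_of_nonneg (h0 t)]
    exact mul_le_mul_of_nonneg_left ht (h0 t))
  rwa [integral_mul_const, h1, one_mul] at this

lemma convolution_eq_const (h1 : ∫ x, φ x = 1) {f : Space → ℝ} {c : ℝ} (hf : ∀ᵐ x, f x = c)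
    (x : Space) : (φ ⋆[lsmul ℝ ℝ, volume] f) x = c := by
  rw [convolution_congr_ae φ hf, convolution_apply, integral_mul_const, h1, one_mul]

end Convolution

lemma lipschitzWith_of_abs_partialDeriv_le {f : Space → ℝ} (hf : Differentiable ℝ f) {C : NNReal}
    (h : ∀ b x, |partialDeriv b f x| ≤ C) : LipschitzWith (3 * C) f := by
  refine lipschitzWith_of_nnnorm_fderiv_le hf fun x => ?_
  rw [← NNReal.coe_le_coe, coe_nnnorm]
  refine ContinuousLinearMap.opNorm_le_bound _ (by positivity) fun v => ?_
  conv_lhs => rw [eq_sum_smul_unitVec v, map_sum]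
  refine (norm_sum_le _ _).trans ?_
  calc ∑ i, ‖fderiv ℝ f x (v i • unitVec i)‖ ≤ ∑ _i : Fin 3, ‖v‖ * C := by
        refine Finset.sum_le_sum fun i _ => ?_
        rw [map_smul, norm_smul]
        exact mul_le_mul (norm_le_pi_norm v i) (h i x) (norm_nonneg _) (norm_nonneg _)
    _ = _ := by simp; ring

/-- Integration by parts for Lipschitz functions shows that both derivatives have the same pairing
with every test function. -/
lemma ae_lineDeriv_eq_of_hasWeakPartial {b : Fin 3} {f g v : Space → ℝ} {K : NNReal}
    (h : HasWeakPartial b f g) (hv : LipschitzWith K v) (hfv : ∀ᵐ x, f x = v x) :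
    ∀ᵐ x, lineDeriv ℝ v x (unitVec b) = g x := by
  refine ae_eq_of_integral_contDiff_smul_eq (hv.locallyIntegrable_lineDeriv _) h.2.1
    fun φ hφ hc => ?_
  obtain ⟨L, hL⟩ := hφ.lipschitzWith_of_hasCompactSupport hc (by simp)
  have h1 := hv.integral_lineDeriv_mul_eq (μ := volume) hL hc (unitVec b)
  have h2 := h.2.2 φ hφ hc
  simp only [smul_eq_mul]
  rw [integral_congr_ae (g := fun x => lineDeriv ℝ v x (unitVec b) * φ x)
    (ae_of_all _ fun x => mul_comm _ _), h1,
    integral_congr_ae (f := fun x => φ x * g x) (g := fun x => g x * φ x)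
    (ae_of_all _ fun x => mul_comm _ _), ← neg_eq_iff_eq_neg.2 h2, ← integral_neg]
  refine integral_congr_ae ?_
  filter_upwards [hfv] with x hx
  rw [(hφ.differentiable (by simp) x).lineDeriv_eq_fderiv, map_neg, hx]
  ring

variable {ℓ d : Fin 3 → ℝ} {e : Space → Mat}

/-- A displacement whose strain is periodic and takes values in the wells is Lipschitz, up to the
choice of a representative, and its increments over the periods are constant. -/
lemma exists_lipschitz_representative (hℓ : ∀ i, 0 < ℓ i) (hper : IsTorusPeriodic ℓ e)
    (he : ∀ᵐ x, e x ∈ wells d) {u : Fin 3 → Space → ℝ} {G : Fin 3 → Fin 3 → Space → ℝ}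
    (hG : ∀ a b, HasWeakPartial b (u a) (G a b))
    (hsym : ∀ᵐ x, ∀ a b, e x a b = (G a b x + G b a x) / 2) :
    ∃ (v : Fin 3 → Space → ℝ) (K : Fin 3 → NNReal), (∀ a, LipschitzWith (K a) (v a)) ∧
      (∀ a, ∀ᵐ x, u a x = v a x) ∧
      (∀ a j x y, v a (x + ℓ j • unitVec j) - v a x = v a (y + ℓ j • unitVec j) - v a y) ∧
      ∀ a x s, v a (x + s • unitVec a) = v a x + s * d a := by
  obtain ⟨φ, hφ, hc, h0, h1, hlim⟩ := exists_mollifier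
  have hu : ∀ a, LocallyIntegrable (u a) := fun a => (hG a 0).1
  have hGi : ∀ a b, LocallyIntegrable (G a b) := fun a b => (hG a b).2.1
  set U : ℕ → Fin 3 → Space → ℝ := fun n a => φ n ⋆[lsmul ℝ ℝ, volume] u a with hU
  have hUs : ∀ n a, ContDiff ℝ ∞ (U n a) := fun n a => contDiff_convolution (hφ n) (hc n) (hu a)
  have hUd : ∀ n a b x, partialDeriv b (U n a) x = (φ n ⋆[lsmul ℝ ℝ, volume] G a b) x :=
    fun n a b x => (hG a b).fderiv_convolution (hφ n) (hc n) x
  have hUdiag : ∀ n a x, partialDeriv a (U n a) x = d a := by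
    intro n a x
    rw [hUd]
    refine convolution_eq_const (h1 n) ?_ x
    filter_upwards [he, hsym] with x hw hx
    have := hx a a
    rw [wells_diag hw] at this
    linarith
  have hUsym : ∀ n a b x, partialDeriv b (U n a) x + partialDeriv a (U n b) x
      = (φ n ⋆[lsmul ℝ ℝ, volume] fun x => G a b x + G b a x) x := fun n a b x => by
    rw [hUd, hUd, convolution_add_right (hφ n) (hc n) (hGi a b) (hGi b a)]
  have hUper : ∀ n j a b x, partialDeriv b (U n a) (x + ℓ j • unitVec j) +
      partialDeriv a (U n b) (x + ℓ j • unitVec j)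
        = partialDeriv b (U n a) x + partialDeriv a (U n b) x := by
    intro n j a b x
    rw [hUsym, hUsym]
    refine convolution_add_of_ae_eq _ ?_ x
    filter_upwards [hsym, ae_comp_add hsym (ℓ j • unitVec j), hper j] with x hx hx' hp
    have e1 := hx a b
    have e2 := hx' a b
    rw [hp] at e2
    linarith
  have hUbd : ∀ n a b x, a ≠ b → |partialDeriv b (U n a) x + partialDeriv a (U n b) x| ≤ 2 := by
    intro n a b x hab
    rw [hUsym]
    refine abs_convolution_le (hφ n) (hc n) (h0 n) (h1 n) ?_ x
    filter_upwards [he, hsym] with x hw hx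
    have e1 := wells_abs_le hw hab
    have e2 := hx a b
    rw [show G a b x + G b a x = 2 * e x a b by linarith, abs_mul, abs_two]
    linarith
  have hUosc : ∀ n a b x y, |partialDeriv b (U n a) x - partialDeriv b (U n a) y| ≤ 4 := fun n =>
    abs_partialDeriv_sub_le hℓ (hUs n) (hUdiag n) (hUper n) (hUbd n)
  have hbound : ∀ a b, ∃ C : ℝ, ∀ n x, |partialDeriv b (U n a) x| ≤ C := by
    intro a b
    -- The oscillation bound is uniform in `n`, so boundedness at one point of convergence bounds
    -- the gradients everywhere, uniformly in `n`.
    obtain ⟨x₀, hx₀⟩ := (hlim _ (hGi a b)).exists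
    obtain ⟨C, hC⟩ := hx₀.abs.bddAbove_range
    refine ⟨C + 4, fun n x => ?_⟩
    have e1 : |partialDeriv b (U n a) x₀| ≤ C := by
      rw [hUd]
      exact hC ⟨n, rfl⟩
    have e2 := hUosc n a b x x₀
    have e3 := abs_sub_abs_le_abs_sub (partialDeriv b (U n a) x) (partialDeriv b (U n a) x₀)
    linarith
  choose C hC using hbound
  have hUlip : ∀ a n, LipschitzWith (3 * ∑ b, (C a b).toNNReal) (U n a) := by
    intro a n
    refine lipschitzWith_of_abs_partialDeriv_le ((hUs n a).differentiable (by simp)) fun b x => ?_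
    have e1 : C a b ≤ (C a b).toNNReal := Real.le_coe_toNNReal _
    have e2 : (C a b).toNNReal ≤ ∑ b, (C a b).toNNReal :=
      Finset.single_le_sum (f := fun b => (C a b).toNNReal) (fun _ _ => zero_le)
        (Finset.mem_univ b)
    exact ((hC a b n x).trans e1).trans (by exact_mod_cast e2)
  have hext : ∀ a, ∃ v : Space → ℝ, LipschitzWith (3 * ∑ b, (C a b).toNNReal) v ∧
      ∀ᵐ x, u a x = v x := by
    intro a
    -- The uniform Lipschitz bound survives on the full-measure set of convergence, and the limit
    -- extends from there.
    have hon : LipschitzOnWith (3 * ∑ b, (C a b).toNNReal) (u a)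
        {x | Tendsto (fun n => U n a x) atTop (𝓝 (u a x))} := by
      refine LipschitzOnWith.of_dist_le_mul fun x hx y hy => ?_
      exact le_of_tendsto' (Tendsto.dist hx hy) fun n => (hUlip a n).dist_le_mul x y
    obtain ⟨v, hv, hEq⟩ := hon.extend_real
    refine ⟨v, hv, ?_⟩
    filter_upwards [hlim _ (hu a)] with x hx using hEq hx
  choose v hv huv using hext
  have hUv : ∀ a, ∀ᵐ x, Tendsto (fun n => U n a x) atTop (𝓝 (v a x)) := by
    intro a
    filter_upwards [hlim _ (hu a), huv a] with x hx hx'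
    rwa [← hx']
  have hcont : ∀ a w, Continuous fun x => v a (x + w) - v a x := fun a w =>
    ((hv a).continuous.comp (by fun_prop)).sub (hv a).continuous
  refine ⟨v, _, hv, huv, fun a j x y => ?_, fun a x s => ?_⟩
  · have hdense : Dense {x | Tendsto (fun n => U n a x) atTop (𝓝 (v a x)) ∧
        Tendsto (fun n => U n a (x + ℓ j • unitVec j)) atTop (𝓝 (v a (x + ℓ j • unitVec j)))} :=
      Measure.dense_of_ae ((hUv a).and (ae_comp_add (hUv a) _))
    obtain ⟨z, hz⟩ := hdense.nonempty
    have := Continuous.ext_on hdense (hcont a (ℓ j • unitVec j))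
      (continuous_const (y := v a (z + ℓ j • unitVec j) - v a z)) (fun x hx =>
        tendsto_nhds_unique (hx.2.sub hx.1) ((hz.2.sub hz.1).congr fun n =>
          sub_eq_of_periodic_symmGradient hℓ (hUs n) (hUdiag n) (hUper n) a j z x))
    exact (congrFun this x).trans (congrFun this y).symm
  · have hdense : Dense {x | Tendsto (fun n => U n a x) atTop (𝓝 (v a x)) ∧
        Tendsto (fun n => U n a (x + s • unitVec a)) atTop (𝓝 (v a (x + s • unitVec a)))} :=
      Measure.dense_of_ae ((hUv a).and (ae_comp_add (hUv a) _))
    have := Continuous.ext_on hdense (hcont a (s • unitVec a))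
      (continuous_const (y := s * d a)) (fun x hx =>
        tendsto_nhds_unique (hx.2.sub hx.1) (tendsto_const_nhds.congr fun n => by
          rw [add_smul_of_fderiv_eq_const ((hUs n a).differentiable (by simp)) (hUdiag n a) x s]
          ring))
    have := congrFun this x
    linarith

/-! ### Periodic part of the displacement and existence of potentials -/

lemma volume_cell_ne_zero (hℓ : ∀ i, 0 < ℓ i) : volume.real (cell ℓ) ≠ 0 := by
  rw [cell, measureReal_def, Real.volume_pi_Ico_toReal (a := fun _ => 0) (fun i => (hℓ i).le)]
  exact Finset.prod_ne_zero_iff.2 fun i _ => by simpa using (hℓ i).ne'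

lemma volume_cell_lt_top : volume (cell ℓ) < ⊤ := by
  rw [cell, Real.volume_pi_Ico (a := fun _ => 0)]
  exact ENNReal.prod_lt_top fun i _ => ENNReal.ofReal_lt_top

lemma integrableOn_lineDeriv {w : Space → ℝ} {K : NNReal} (hw : LipschitzWith K w) (v : Space) :
    IntegrableOn (fun x => lineDeriv ℝ w x v) (cell ℓ) :=
  Measure.integrableOn_of_bounded volume_cell_lt_top.ne
    (aestronglyMeasurable_lineDeriv hw.continuous volume)
    (ae_of_all _ fun _ => norm_lineDeriv_le_of_lipschitz ℝ hw)

/-- The partial derivatives of a periodic Lipschitz function have zero mean. -/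
lemma setIntegral_lineDeriv_eq_zero (hℓ : ∀ i, 0 < ℓ i) {w : Space → ℝ} {K : NNReal}
    (hw : LipschitzWith K w) (b : Fin 3) (hper : ∀ x, w (x + ℓ b • unitVec b) = w x) :
    ∫ x in cell ℓ, lineDeriv ℝ w x (unitVec b) = 0 := by
  obtain ⟨σ, hσ0, hσ1, hσ2⟩ := exists_perm (fin_ne_add_one b) (fin_ne_add_two b)
    (fin_add_one_ne_add_two b)
  set B : Set (ℝ × ℝ) := Ico 0 (ℓ (b + 1)) ×ˢ Ico 0 (ℓ (b + 2)) with hB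
  have hcell : (coords σ).symm ⁻¹' cell ℓ = Ico 0 (ℓ b) ×ˢ B := by
    ext q
    have hq : coords σ ((coords σ).symm q) = q := MeasurableEquiv.apply_symm_apply _ _
    rw [coords_apply, hσ0, hσ1, hσ2] at hq
    simp only [Prod.ext_iff] at hq
    rw [mem_preimage, cell, mem_univ_pi, forall_fin_iff_cyclic b, hq.1, hq.2.1, hq.2.2]
    rfl
  have hshift : ∀ (r s : ℝ) (q : ℝ × ℝ),
      (coords σ).symm (r + s, q) = (coords σ).symm (r, q) + s • unitVec b := by
    intro r s q
    apply (coords σ).injective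
    have hq : coords σ ((coords σ).symm (r, q)) = (r, q) := MeasurableEquiv.apply_symm_apply _ _
    rw [MeasurableEquiv.apply_symm_apply, coords_apply, hσ0, hσ1, hσ2]
    rw [coords_apply, hσ0, hσ1, hσ2, Prod.mk.injEq] at hq
    simp only [Pi.add_apply, Pi.smul_apply, unitVec, Pi.single_eq_same,
      Pi.single_eq_of_ne (fin_ne_add_one b).symm, Pi.single_eq_of_ne (fin_ne_add_two b).symm,
      smul_eq_mul, mul_one, mul_zero, add_zero, hq.1, hq.2]
  have hmp := (measurePreserving_coords σ).symm
  rw [← hmp.setIntegral_preimage_emb (coords σ).symm.measurableEmbedding, hcell,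
    Measure.volume_eq_prod, ← Measure.prod_restrict]
  have hint : IntegrableOn (fun q => lineDeriv ℝ w ((coords σ).symm q) (unitVec b))
      (Ico 0 (ℓ b) ×ˢ B) := by
    rw [← hcell]
    exact (hmp.integrableOn_comp_preimage (coords σ).symm.measurableEmbedding).2
      (integrableOn_lineDeriv hw _)
  rw [IntegrableOn, Measure.volume_eq_prod, ← Measure.prod_restrict] at hint
  -- The direction `b` is integrated first: along it the integrand is the derivative of a function
  -- with equal values at both ends of the period.
  rw [integral_prod_symm _ hint]
  refine integral_eq_zero_of_ae (ae_of_all _ fun q => ?_)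
  simp only [Pi.zero_apply]
  set g : ℝ → ℝ := fun r => w ((coords σ).symm (r, q)) with hg
  have hgl : LipschitzWith (K * (1 * ‖unitVec b‖₊)) g := by
    have : g = fun r => w ((coords σ).symm (0, q) + r • unitVec b) := by
      funext r
      rw [← hshift, zero_add]
    rw [this]
    refine hw.comp (LipschitzWith.of_dist_le_mul fun r s => ?_)
    rw [dist_add_left, dist_eq_norm, ← sub_smul, norm_smul, ← dist_eq_norm]
    simp [mul_comm]
  have hderiv : ∀ r, lineDeriv ℝ w ((coords σ).symm (r, q)) (unitVec b) = deriv g r := by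
    intro r
    have : (fun t : ℝ => w ((coords σ).symm (r, q) + t • unitVec b)) = fun t => g (r + t) := by
      funext t
      rw [← hshift]
    rw [lineDeriv, this, deriv_comp_const_add, add_zero]
  simp only [hderiv]
  rw [integral_Ico_eq_integral_Ioc, ← intervalIntegral.integral_of_le (hℓ b).le,
    (absolutelyContinuousOnInterval_of_lipschitz hgl 0 (ℓ b)).integral_deriv_eq_sub, sub_eq_zero]
  have := hshift 0 (ℓ b) q
  rw [zero_add] at this
  simp only [hg, this, hper]

lemma sum_mul_add_smul_unitVec (c : Fin 3 → ℝ) (x : Space) (s : ℝ) (b : Fin 3) :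
    ∑ j, c j * (x + s • unitVec b) j = (∑ j, c j * x j) + s * c b := by
  simp [unitVec, Pi.single_apply, mul_add, Finset.sum_add_distrib]
  ring

lemma hasLineDerivAt_linear (c : Fin 3 → ℝ) (b : Fin 3) (x : Space) :
    HasLineDerivAt ℝ (fun x : Space => ∑ j, c j * x j) (c b) x (unitVec b) := by
  have h : (fun t : ℝ => ∑ j, c j * (x + t • unitVec b) j) = fun t => (∑ j, c j * x j) + t * c b := by
    funext t
    exact sum_mul_add_smul_unitVec c x t b
  rw [HasLineDerivAt, h]
  simpa using ((hasDerivAt_id (0 : ℝ)).mul_const (c b)).const_add (∑ j, c j * x j)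

/-- Periodic Lipschitz functions `w_a`, independent of `x_a`, which differ from half of the
displacement by a linear function. -/
lemma exists_periodic_part (hℓ : ∀ i, 0 < ℓ i) (hper : IsTorusPeriodic ℓ e)
    (he : ∀ᵐ x, e x ∈ wells d) (hgrad : IsSymmetrizedGradient e) :
    ∃ (w : Fin 3 → Space → ℝ) (K : Fin 3 → NNReal) (c : Fin 3 → Fin 3 → ℝ),
      (∀ a, LipschitzWith (K a) (w a)) ∧
      (∀ a j x, w a (x + ℓ j • unitVec j) = w a x) ∧
      (∀ a x (s : ℝ), w a (x + s • unitVec a) = w a x) ∧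
      ∀ a b, ∀ᵐ x, e x a b = lineDeriv ℝ (w a) x (unitVec b) + lineDeriv ℝ (w b) x (unitVec a)
        + c a b := by
  obtain ⟨u, G, hG, hsym⟩ := hgrad
  obtain ⟨v, K, hv, huv, hquasi, hdiag⟩ := exists_lipschitz_representative hℓ hper he hG hsym
  -- Mean slopes over the periods. Subtracting the linear map they define makes `v a` periodic; as
  -- `τ a a = d a`, it also removes the dependence on `x a`.
  set τ : Fin 3 → Fin 3 → ℝ := fun a j => (v a (0 + ℓ j • unitVec j) - v a 0) / ℓ j with hτ
  have hlip : ∀ a, ∃ L : NNReal, LipschitzWith L fun x => (v a x - ∑ j, τ a j * x j) / 2 := by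
    intro a
    set A := ∑ j, τ a j • ContinuousLinearMap.proj (R := ℝ) (φ := fun _ : Fin 3 => ℝ) j with hA
    have h3 := (lipschitzWith_smul (2⁻¹ : ℝ)).comp ((hv a).sub A.lipschitz)
    refine ⟨‖(2⁻¹ : ℝ)‖₊ * (K a + ‖A‖₊), ?_⟩
    convert! h3 using 2 with x
    simp [hA, div_eq_inv_mul]
  choose L hL using hlip
  refine ⟨fun a x => (v a x - ∑ j, τ a j * x j) / 2, L, fun a b => (τ a b + τ b a) / 2, hL,
    fun a j x => ?_, fun a x s => ?_, fun a b => ?_⟩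
  · have h1 := hquasi a j x 0
    have h2 : ℓ j * τ a j = v a (0 + ℓ j • unitVec j) - v a 0 := by
      rw [hτ]
      exact mul_div_cancel₀ _ (hℓ j).ne'
    simp only [sum_mul_add_smul_unitVec, h2]
    linarith
  · have h2 : τ a a = d a := by
      simp only [hτ, hdiag]
      have := (hℓ a).ne'
      field_simp
      ring
    simp only [sum_mul_add_smul_unitVec, hdiag, h2]
    ring
  · have key : ∀ a b, ∀ᵐ x, lineDeriv ℝ (fun x => (v a x - ∑ j, τ a j * x j) / 2) x (unitVec b)
        = (G a b x - τ a b) / 2 := by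
      intro a b
      filter_upwards [ae_lineDeriv_eq_of_hasWeakPartial (hG a b) (hv a) (huv a),
        (hv a).ae_lineDifferentiableAt (μ := volume) (unitVec b)] with x h1 h2
      have h3 := h2.hasLineDerivAt
      rw [h1] at h3
      have h4 : HasLineDerivAt ℝ (fun x => (v a x - ∑ j, τ a j * x j) / 2)
          ((G a b x - τ a b) / 2) x (unitVec b) :=
        HasDerivAt.div_const (HasDerivAt.sub h3 (hasLineDerivAt_linear (τ a) b x)) 2
      exact h4.lineDeriv
    filter_upwards [key a b, key b a, hsym] with x h1 h2 h3
    rw [h1, h2, h3]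
    ring

lemma exists_isStrainPotential (hℓ : ∀ i, 0 < ℓ i) (hper : IsTorusPeriodic ℓ e)
    (he : ∀ᵐ x, e x ∈ wells d) (hgrad : IsSymmetrizedGradient e) :
    ∃ Ψ : Fin 3 → ℝ × ℝ → ℝ, IsStrainPotential ℓ e Ψ := by
  obtain ⟨w, K, c, hw, hwper, hwself, hwe⟩ := exists_periodic_part hℓ hper he hgrad
  -- Derivatives of periodic Lipschitz functions have zero mean, so only the constant remains.
  have havg : ∀ a b, avg ℓ e a b = c a b := by
    intro a b
    have h1 := integrableOn_lineDeriv (ℓ := ℓ) (hw a) (unitVec b)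
    have h2 := integrableOn_lineDeriv (ℓ := ℓ) (hw b) (unitVec a)
    have h3 : IntegrableOn (fun _ : Space => c a b) (cell ℓ) :=
      integrableOn_const volume_cell_lt_top.ne
    rw [avg, setAverage_eq, integral_congr_ae (ae_restrict_of_ae (hwe a b)),
      integral_add (f := fun x => lineDeriv ℝ (w a) x (unitVec b) + lineDeriv ℝ (w b) x (unitVec a))
        (h1.add h2) h3, integral_add h1 h2,
      setIntegral_lineDeriv_eq_zero hℓ (hw a) b (hwper a b),
      setIntegral_lineDeriv_eq_zero hℓ (hw b) a (hwper b a), setIntegral_const, zero_add, zero_add,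
      smul_smul, inv_mul_cancel₀ (volume_cell_ne_zero hℓ), one_smul]
  -- The potential `Ψ i` is `w (i + 2)` restricted to the plane `x (i + 2) = 0`; nothing is lost, as
  -- `w (i + 2)` does not depend on that coordinate.
  set pt : Fin 3 → ℝ × ℝ → Space := fun i p => p.1 • unitVec i + p.2 • unitVec (i + 1) with hpt
  have hwpt : ∀ i x, w (i + 2) x = w (i + 2) (pt i (x i, x (i + 1))) := by
    intro i x
    rw [← hwself (i + 2) (pt i (x i, x (i + 1))) (x (i + 2))]
    congr 1
    conv_lhs => rw [eq_sum_smul_unitVec x]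
    ext j
    simp only [hpt, unitVec, Finset.sum_apply, Pi.add_apply, Pi.smul_apply, smul_eq_mul]
    fin_cases i <;> fin_cases j <;> simp [Pi.single_apply]
  have hfst : ∀ i (x : Space), dFst (fun p => w (i + 2) (pt i p)) (x i) (x (i + 1))
      = lineDeriv ℝ (w (i + 2)) x (unitVec i) := by
    intro i x
    have h : (fun t : ℝ => w (i + 2) (x + t • unitVec i))
        = fun t => w (i + 2) (pt i (x i + t, x (i + 1))) := by
      funext t
      rw [hwpt]
      simp [unitVec, (fin_ne_add_one i).symm]
    rw [lineDeriv, h, deriv_comp_const_add (fun s => w (i + 2) (pt i (s, x (i + 1)))), add_zero]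
    rfl
  have hsnd : ∀ i (x : Space), dSnd (fun p => w (i + 2) (pt i p)) (x i) (x (i + 1))
      = lineDeriv ℝ (w (i + 2)) x (unitVec (i + 1)) := by
    intro i x
    have h : (fun t : ℝ => w (i + 2) (x + t • unitVec (i + 1)))
        = fun t => w (i + 2) (pt i (x i, x (i + 1) + t)) := by
      funext t
      rw [hwpt]
      simp [unitVec, fin_ne_add_one i]
    rw [lineDeriv, h, deriv_comp_const_add (fun s => w (i + 2) (pt i (x i, s))), add_zero]
    rfl
  refine ⟨fun i p => w (i + 2) (pt i p), fun i => ?_, fun i s t => ?_, fun i s t => ?_,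
    fun i => ?_⟩
  · have h1 : LipschitzWith _ (pt i) :=
      (((ContinuousLinearMap.fst ℝ ℝ ℝ).smulRight (unitVec i)) +
        ((ContinuousLinearMap.snd ℝ ℝ ℝ).smulRight (unitVec (i + 1)))).lipschitz
    exact ⟨_, (hw (i + 2)).comp h1⟩
  · simp only [hpt, add_smul, add_right_comm _ (ℓ i • unitVec i), hwper]
  · simp only [hpt, add_smul, ← add_assoc, hwper]
  · filter_upwards [hwe i (i + 1)] with x hx
    have h1 := hfst (i + 1) x
    have h2 := hsnd (i + 2) x
    simp only [fin_add_two_one, fin_add_two_two, fin_add_one_one, fin_add_one_two] at h1 h2 ⊢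
    rw [hx, h1, h2, havg]

lemma locallyIntegrable_of_isSymmetrizedGradient (hgrad : IsSymmetrizedGradient e) (a b : Fin 3) :
    LocallyIntegrable fun x => e x a b := by
  obtain ⟨u, G, hG, hsym⟩ := hgrad
  have h : LocallyIntegrable fun x => (2⁻¹ : ℝ) • (G a b x + G b a x) :=
    ((hG a b).2.1.add (hG b a).2.1).smul (2⁻¹ : ℝ)
  refine h.congr ?_
  filter_upwards [hsym] with x hx
  rw [hx, smul_eq_mul]
  ring

end CubicTrigonal

end

theorem proposition3p3 (ℓ d : Fin 3 → ℝ) (hℓ : ∀ i, 0 < ℓ i)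
    (e : CubicTrigonal.Space → CubicTrigonal.Mat)
    (he_per : CubicTrigonal.IsTorusPeriodic ℓ e)
    (he_grad : CubicTrigonal.IsSymmetrizedGradient e)
    (he_incl : ∀ᵐ x : CubicTrigonal.Space, e x ∈ CubicTrigonal.wells d) :
    (∃ Ψ : Fin 3 → ℝ × ℝ → ℝ, CubicTrigonal.IsStrainPotential ℓ e Ψ) ∧
    (∃ i : Fin 3, CubicTrigonal.PartialVanishes i e) ∧
    ∀ Ψ : Fin 3 → ℝ × ℝ → ℝ, CubicTrigonal.IsStrainPotential ℓ e Ψ →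
      ∀ i : Fin 3, CubicTrigonal.PartialVanishes i e →
        CubicTrigonal.DecompositionOne ℓ e Ψ i ∨ CubicTrigonal.DecompositionTwo ℓ e Ψ i := by
  obtain ⟨Ψ, hΨ⟩ := CubicTrigonal.exists_isStrainPotential hℓ he_per he_incl he_grad
  refine ⟨⟨Ψ, hΨ⟩, ?_, fun Φ hΦ i hi => ?_⟩
  · obtain ⟨i, hA, hB⟩ := CubicTrigonal.exists_potentials_const hℓ he_incl hΨ
    exact ⟨i, CubicTrigonal.partialVanishes_of_potentials_const he_incl
      (CubicTrigonal.locallyIntegrable_of_isSymmetrizedGradient he_grad) hΨ hA hB⟩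
  · obtain ⟨hA, hB⟩ := CubicTrigonal.potentials_const_of_partialVanishes hℓ hΦ hi
    exact CubicTrigonal.decompositions_of_potentials_const hℓ he_incl hΦ hA hB
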